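/- For a polynomial $P(x)=a_d\prod_{k=1}^d(x-\mu_k)\in\mathbb{C}[x]$ with $a_d\ne 0$ let $M(P)=\exp\big(\frac1{2\pi}\int_0^{2\pi}\log|P(e^{it})|\,dt\big)=|a_d|\prod_{|\mu_k|\ge 1}|\mu_k|$ be its Mahler measure, and call $P$ self-reciprocal if $P(x)=x^dP(1/x)$. Let $m\ge 1$ be an integer. For every $\varepsilon>0$ there exist $D_0=D_0(\varepsilon,m)$ and $\delta=\delta(\varepsilon,m)>0$ such that the following holds for every monic, irreducible, self-reciprocal polynomial $P\in\mathbb{Z}[x]$ of degree $d\ge D_0$ with $M(P)>1$ whose Mahler measure is small in the sense that $\log M(P)\le \delta\, d\log d$ (for instance, if $\log M(P)\le\phi(d)$ with a fixed $\phi(d)=o(d\log d)$ and $d$ is large enough in terms of $\varepsilon$, $m$ and $\phi$). For every $\mu\in\mathbb{C}$ with $P(\mu)=0$ and every $\omega\in\mathbb{C}$ with $\omega^m=1$ or $\omega^m=-1$, \[|\omega-\mu|\ \ge\ \exp\Big(-\Big(\frac{\pi\sqrt m}{8}+\varepsilon\Big)\sqrt{d\log d\,\log M(P)}\Big),\] and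 if moreover $\mu\notin\mathbb{R}$ and $|\mu|\ne 1$, then \[|\omega-\mu|\ \ge\ \exp\Big(-\Big(\frac{\pi\sqrt m}{16}+\varepsilon\Big)\sqrt{d\log d\,\log M(P)}\Big).\] -/

import Mathlib

/-! ### Positivity of the regularised logarithmic energy -/

/-! Write d for the degree, ℓ = log M(P), σ = ω^m = ±1. No root α of P is a root of unity, so for
each n ≥ 1 the product of 1 - (σα^m)^n over all roots is a nonzero integer, and the sum of the log|1
- (σα^m)^n| is nonnegative. Average this over n < J with a probability weight. A root close to ω
makes a very negative contribution, which the other roots must compensate; so everything rests on a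
uniform upper bound for the averaged log|1 - y^n|.

That bound comes from positivity of logarithmic energy: -log|1 - z w̄| is a positive semidefinite
kernel on the disc, once regularised by a factor r < 1. Applied to the points z^i on the circle with
weights t_i = sin(iπ/J), it controls the average over n = j - i with weight t_i t_j; the maximum
principle and inversion carry the bound to all y. The outcome (`exists_weights`) is about π² log
J/(8J) + (J/4) log⁺|y|. Hence c roots that are δ-close satisfy, up to lower order terms, c·(-log δ)
≤ dπ² log J/(8J) + mJℓ/4 (`card_mul_neg_log_le`).

Take J near (π/2)√(d log d/(mℓ)) (`exists_J_le`). If ℓ is not smaller than a tiny negative power of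
d, then log J is at most about (log d)/2 and the right side is (π√m/4)√(d log d·ℓ). Self-reciprocity
gives c = 2 through μ and 1/μ; conjugation gives c = 4 off the real line and the unit circle.

The lower bound for ℓ is a weak Dobrowolski theorem (`rpow_neg_le_log_mahlerMeasure`), proved with
the same energy. Put weight T on the roots and weight 1 on their p-th powers for primes p ≤ N. The
congruence P(x^p) ≡ P(x)^p mod p makes the interaction of roots with p-th powers at least about d
log p, and for very small ℓ this contradicts positivity. -/

theorem hasSum_neg_log_norm_one_sub {u : ℂ} (hu : ‖u‖ < 1) :
    HasSum (fun n : ℕ => (u ^ n / n).re) (-Real.log ‖1 - u‖) := by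
  have h := Complex.hasSum_re (Complex.hasSum_taylorSeries_neg_log hu)
  simpa [Complex.log_re] using h

/-- Expanding each logarithm as a power series turns the double sum into squared power sums with
nonnegative coefficients r^n/n, which is the source of all positivity here. The n = 0 term vanishes
because division by zero gives 0. -/
theorem hasSum_energy {ι : Type*} (s : Finset ι) (t : ι → ℝ) (z : ι → ℂ)
    (hz : ∀ i ∈ s, ‖z i‖ ≤ 1) {r : ℝ} (hr0 : 0 ≤ r) (hr1 : r < 1) :
    HasSum (fun n : ℕ => r ^ n / n * ‖∑ i ∈ s, (t i : ℂ) * z i ^ n‖ ^ 2)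
      (-∑ i ∈ s, ∑ j ∈ s,
        t i * t j * Real.log ‖1 - r * (z i * (starRingEnd ℂ) (z j))‖) := by
  have h1 : ∀ i ∈ s, ∀ j ∈ s, HasSum (fun n : ℕ => t i * t j *
      (((r : ℂ) * (z i * (starRingEnd ℂ) (z j))) ^ n / n).re)
      (t i * t j * -Real.log ‖1 - r * (z i * (starRingEnd ℂ) (z j))‖) := by
    intro i hi j hj
    refine (hasSum_neg_log_norm_one_sub ?_).mul_left _
    rw [norm_mul, norm_mul, RCLike.norm_conj, Complex.norm_real, Real.norm_of_nonneg hr0]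
    have : ‖z i‖ * ‖z j‖ ≤ 1 := mul_le_one₀ (hz i hi) (norm_nonneg _) (hz j hj)
    nlinarith
  have h2 := hasSum_sum (fun i hi => hasSum_sum (fun j hj => h1 i hi j hj))
  convert! h2 using 1
  · funext n
    have : (‖∑ i ∈ s, (t i : ℂ) * z i ^ n‖ ^ 2 : ℝ)
        = (∑ i ∈ s, ∑ j ∈ s, (t i : ℂ) * t j * (z i * (starRingEnd ℂ) (z j)) ^ n).re := by
      rw [← Complex.ofReal_re (‖∑ i ∈ s, (t i : ℂ) * z i ^ n‖ ^ 2)]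
      congr 1
      push_cast
      rw [← Complex.mul_conj', map_sum, Finset.sum_mul_sum]
      refine Finset.sum_congr rfl fun i _ => Finset.sum_congr rfl fun j _ => ?_
      simp only [map_mul, map_pow, Complex.conj_ofReal]
      ring
    rw [this, Complex.re_sum, Finset.mul_sum]
    refine Finset.sum_congr rfl fun i _ => ?_
    rw [Complex.re_sum, Finset.mul_sum]
    refine Finset.sum_congr rfl fun j _ => ?_
    have e1 : ((r : ℂ) * (z i * (starRingEnd ℂ) (z j))) ^ n / n
        = ((r ^ n / n : ℝ) : ℂ) * (z i * (starRingEnd ℂ) (z j)) ^ n := by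
      push_cast; ring
    rw [e1, Complex.re_ofReal_mul, ← Complex.ofReal_mul, Complex.re_ofReal_mul]
    ring
  · simp [Finset.sum_neg_distrib]

theorem energy_nonneg {ι : Type*} (s : Finset ι) (t : ι → ℝ) (z : ι → ℂ)
    (hz : ∀ i ∈ s, ‖z i‖ ≤ 1) {r : ℝ} (hr0 : 0 ≤ r) (hr1 : r < 1) :
    ∑ i ∈ s, ∑ j ∈ s, t i * t j * Real.log ‖1 - r * (z i * (starRingEnd ℂ) (z j))‖ ≤ 0 := by
  have h := (hasSum_energy s t z hz hr0 hr1).nonneg (fun n => by positivity)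
  linarith

theorem norm_one_sub_le_of_norm_le_one {u : ℂ} (hu : ‖u‖ ≤ 1) {r : ℝ} (hr0 : 0 ≤ r) (hr1 : r ≤ 1) :
    (1 + r) * ‖1 - u‖ ≤ 2 * ‖1 - r * u‖ := by
  have hq : u.re ^ 2 + u.im ^ 2 ≤ 1 := by
    have := Complex.sq_norm u
    rw [Complex.normSq_apply] at this
    nlinarith [norm_nonneg u]
  refine (sq_le_sq₀ (by positivity) (by positivity)).1 ?_
  rw [mul_pow, mul_pow, Complex.sq_norm, Complex.sq_norm, Complex.normSq_apply, Complex.normSq_apply]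
  simp only [Complex.sub_re, Complex.one_re, Complex.sub_im, Complex.one_im, Complex.mul_re,
    Complex.ofReal_re, Complex.ofReal_im, Complex.mul_im, zero_mul, sub_zero, add_zero]
  have hx : -1 ≤ u.re := by nlinarith [sq_nonneg u.im]
  have key : 0 ≤ (1 - r) * (3 + r + 2 * (1 - r) * u.re - (u.re ^ 2 + u.im ^ 2) * (1 + 3 * r)) := by
    refine mul_nonneg (by linarith) ?_
    nlinarith [mul_nonneg (sub_nonneg.2 hr1) (by linarith : 0 ≤ u.re + 1)]
  nlinarith

/-- The price of regularisation: at most 1 - r per pair of points. The extremal case of the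
preceding inequality is u = -1, where the ratio is 2/(1 + r). -/
theorem log_norm_one_sub_le {u : ℂ} (hu : ‖u‖ ≤ 1) (hu1 : u ≠ 1) {r : ℝ} (hr0 : 0 ≤ r)
    (hr1 : r ≤ 1) : Real.log ‖1 - u‖ ≤ Real.log ‖1 - r * u‖ + (1 - r) := by
  have h := norm_one_sub_le_of_norm_le_one hu hr0 hr1
  have hpos : 0 < ‖1 - u‖ := norm_pos_iff.2 (sub_ne_zero.2 (Ne.symm hu1))
  have hpos2 : 0 < ‖1 - r * u‖ := by nlinarith
  have h2 : Real.log ((1 + r) / 2 * ‖1 - u‖) ≤ Real.log ‖1 - r * u‖ :=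
    Real.log_le_log (by positivity) (by linarith)
  rw [Real.log_mul (by positivity) hpos.ne'] at h2
  have h3 := Real.one_sub_inv_le_log_of_pos (by positivity : 0 < (1 + r) / 2)
  have h4 : -(1 - r) ≤ 1 - ((1 + r) / 2)⁻¹ := by
    rw [inv_div, neg_le_sub_iff_le_add, div_le_iff₀ (by linarith)]
    nlinarith
  linarith

theorem log_one_sub_le_log_norm {u : ℂ} (hu : ‖u‖ ≤ 1) {r : ℝ} (hr0 : 0 ≤ r) (hr1 : r < 1) :
    Real.log (1 - r) ≤ Real.log ‖1 - r * u‖ := by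
  refine Real.log_le_log (by linarith) ?_
  have h := norm_sub_norm_le (1 : ℂ) (r * u)
  rw [norm_one, norm_mul, Complex.norm_real, Real.norm_of_nonneg hr0] at h
  nlinarith

/-! ### Reflection in the unit circle -/

/-- Reflection of the exterior of the unit disc into the disc. -/
noncomputable def discReflect (z : ℂ) : ℂ := if ‖z‖ ≤ 1 then z else ((starRingEnd ℂ) z)⁻¹

theorem norm_discReflect_le_one (z : ℂ) : ‖discReflect z‖ ≤ 1 := by
  unfold discReflect
  split_ifs with h
  · exact h
  · rw [norm_inv, RCLike.norm_conj]
    exact inv_le_one_of_one_le₀ (by linarith)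

theorem discReflect_pow (z : ℂ) {n : ℕ} (hn : n ≠ 0) : discReflect (z ^ n) = discReflect z ^ n := by
  unfold discReflect
  have : ‖z ^ n‖ ≤ 1 ↔ ‖z‖ ≤ 1 := by rw [norm_pow, pow_le_one_iff_of_nonneg (norm_nonneg _) hn]
  simp only [this]
  split_ifs <;> simp

/-- The difference of the squares of the two sides is (1 - |a|²)(1 - |b|²). -/
theorem norm_sub_le_norm_one_sub_mul_conj {a b : ℂ} (ha : ‖a‖ ≤ 1) (hb : ‖b‖ ≤ 1) :
    ‖a - b‖ ≤ ‖1 - a * (starRingEnd ℂ) b‖ := by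
  have h1 : a.re ^ 2 + a.im ^ 2 ≤ 1 := by
    have := Complex.sq_norm a
    rw [Complex.normSq_apply] at this
    nlinarith [norm_nonneg a]
  have h2 : b.re ^ 2 + b.im ^ 2 ≤ 1 := by
    have := Complex.sq_norm b
    rw [Complex.normSq_apply] at this
    nlinarith [norm_nonneg b]
  refine (sq_le_sq₀ (norm_nonneg _) (norm_nonneg _)).1 ?_
  rw [Complex.sq_norm, Complex.sq_norm, Complex.normSq_apply, Complex.normSq_apply]
  simp only [Complex.sub_re, Complex.one_re, Complex.sub_im, Complex.one_im, Complex.mul_re,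
    Complex.mul_im, Complex.conj_re, Complex.conj_im]
  nlinarith [mul_nonneg (sub_nonneg.2 h1) (sub_nonneg.2 h2)]

theorem norm_sub_le_discReflect (a b : ℂ) :
    ‖a - b‖ ≤ max 1 ‖a‖ * max 1 ‖b‖ *
      ‖1 - discReflect a * (starRingEnd ℂ) (discReflect b)‖ := by
  by_cases ha : ‖a‖ ≤ 1 <;> by_cases hb : ‖b‖ ≤ 1
  · simpa [discReflect, ha, hb] using norm_sub_le_norm_one_sub_mul_conj ha hb
  · have hb0 : b ≠ 0 := by rintro rfl; simp at hb
    have : max 1 ‖b‖ = ‖b‖ := max_eq_right (by linarith)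
    simp only [discReflect, ha, hb, if_true, if_false, this, max_eq_left ha, one_mul, ← norm_mul,
      map_inv₀, Complex.conj_conj]
    rw [mul_sub, mul_one, mul_comm a, mul_inv_cancel_left₀ hb0, norm_sub_rev]
  · have ha0 : a ≠ 0 := by rintro rfl; simp at ha
    have : max 1 ‖a‖ = ‖a‖ := max_eq_right (by linarith)
    simp only [discReflect, ha, hb, if_true, if_false, this, max_eq_left hb, mul_one]
    rw [← RCLike.norm_conj a, ← norm_mul, mul_sub, mul_one,
      mul_inv_cancel_left₀ ((map_ne_zero _).2 ha0), ← map_sub, RCLike.norm_conj]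
  · have ha0 : a ≠ 0 := by rintro rfl; simp at ha
    have hb0 : b ≠ 0 := by rintro rfl; simp at hb
    have h1 : max 1 ‖a‖ = ‖a‖ := max_eq_right (by linarith)
    have h2 : max 1 ‖b‖ = ‖b‖ := max_eq_right (by linarith)
    simp only [discReflect, ha, hb, if_false, h1, h2, map_inv₀, Complex.conj_conj]
    have h := norm_sub_le_norm_one_sub_mul_conj (a := ((starRingEnd ℂ) a)⁻¹)
      (b := ((starRingEnd ℂ) b)⁻¹)
      (by rw [norm_inv, RCLike.norm_conj]; exact inv_le_one_of_one_le₀ (by linarith))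
      (by rw [norm_inv, RCLike.norm_conj]; exact inv_le_one_of_one_le₀ (by linarith))
    rw [map_inv₀, Complex.conj_conj] at h
    refine le_trans (le_of_eq ?_) (mul_le_mul_of_nonneg_left h (by positivity))
    rw [← map_inv₀, ← map_inv₀, ← map_sub, RCLike.norm_conj, ← norm_mul, ← norm_mul,
      norm_sub_rev a b]
    congr 1
    field_simp

/-- Lower bound for the regularised kernel at two distinct points in terms of their distance. -/
theorem log_norm_sub_le_kernel {a b : ℂ} (hab : a ≠ b) {r : ℝ} (hr0 : 0 ≤ r) (hr1 : r ≤ 1) :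
    Real.log ‖a - b‖ ≤ Real.log ‖1 - r * (discReflect a * (starRingEnd ℂ) (discReflect b))‖
      + (1 - r) + Real.posLog ‖a‖ + Real.posLog ‖b‖ := by
  have h := norm_sub_le_discReflect a b
  have hpos : 0 < ‖a - b‖ := norm_pos_iff.2 (sub_ne_zero.2 hab)
  have hk : 0 < ‖1 - discReflect a * (starRingEnd ℂ) (discReflect b)‖ := by
    by_contra hk
    have : ‖1 - discReflect a * (starRingEnd ℂ) (discReflect b)‖ = 0 :=
      le_antisymm (not_lt.1 hk) (norm_nonneg _)
    rw [this, mul_zero] at h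
    linarith
  have h1 := Real.log_le_log hpos h
  rw [Real.log_mul (by positivity) hk.ne', Real.log_mul (by positivity) (by positivity),
    ← Real.posLog_eq_log_max_one (norm_nonneg _), ← Real.posLog_eq_log_max_one (norm_nonneg _)] at h1
  have h2 : ‖discReflect a * (starRingEnd ℂ) (discReflect b)‖ ≤ 1 := by
    rw [norm_mul, RCLike.norm_conj]
    exact mul_le_one₀ (norm_discReflect_le_one a) (norm_nonneg _) (norm_discReflect_le_one b)
  have h3 := log_norm_one_sub_le h2 (fun e => by rw [e, sub_self, norm_zero] at hk; exact hk.false)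
    hr0 hr1
  linarith

/-! ### Products over the complex roots of an irreducible integer polynomial -/

/-- The complex roots of an integer polynomial. -/
noncomputable def complexRoots (P : Polynomial ℤ) : Finset ℂ :=
  (P.map (Int.castRingHom ℂ)).roots.toFinset

section

open Polynomial

theorem mem_complexRoots {P : ℤ[X]} (hP : P.Monic) {α : ℂ} :
    α ∈ complexRoots P ↔ aeval α P = 0 := by
  rw [complexRoots, Multiset.mem_toFinset, mem_roots (hP.map _).ne_zero, IsRoot.def, eval_map,
    aeval_def]
  rfl

theorem nodup_roots_map {P : ℤ[X]} (hP : P.Monic) (hirr : Irreducible P) :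
    (P.map (Int.castRingHom ℂ)).roots.Nodup := by
  have h := (IsPrimitive.Int.irreducible_iff_irreducible_map_cast hP.isPrimitive).1 hirr
  have h2 := nodup_roots (h.separable.map (f := algebraMap ℚ ℂ))
  rwa [Polynomial.map_map, RingHom.ext_int ((algebraMap ℚ ℂ).comp (Int.castRingHom ℚ))
    (Int.castRingHom ℂ)] at h2

theorem sum_complexRoots {P : ℤ[X]} (hP : P.Monic) (hirr : Irreducible P) (f : ℂ → ℝ) :
    ∑ α ∈ complexRoots P, f α = ((P.map (Int.castRingHom ℂ)).roots.map f).sum := by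
  rw [complexRoots, Finset.sum, Multiset.toFinset_val, (nodup_roots_map hP hirr).dedup]

theorem prod_complexRoots {P : ℤ[X]} (hP : P.Monic) (hirr : Irreducible P) (f : ℂ → ℂ) :
    ∏ α ∈ complexRoots P, f α = ((P.map (Int.castRingHom ℂ)).roots.map f).prod := by
  rw [complexRoots, Finset.prod, Multiset.toFinset_val, (nodup_roots_map hP hirr).dedup]

theorem card_complexRoots {P : ℤ[X]} (hP : P.Monic) (hirr : Irreducible P) :
    (complexRoots P).card = P.natDegree := by
  rw [complexRoots, Multiset.toFinset_card_of_nodup (nodup_roots_map hP hirr),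
    IsAlgClosed.card_roots_eq_natDegree, hP.natDegree_map]

theorem log_mahlerMeasure_eq {P : ℤ[X]} (hP : P.Monic) (hirr : Irreducible P) :
    Real.log (P.map (Int.castRingHom ℂ)).mahlerMeasure
      = ∑ α ∈ complexRoots P, Real.posLog ‖α‖ := by
  rw [sum_complexRoots hP hirr, ← logMahlerMeasure_eq_log_MahlerMeasure,
    logMahlerMeasure_eq_log_leadingCoeff_add_sum_log_roots, (hP.map _).leadingCoeff]
  simp

theorem exists_int_eq_prod_aeval {P : ℤ[X]} (hP : P.Monic) (hirr : Irreducible P) (Q : ℤ[X]) :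
    ∃ k : ℤ, ∏ α ∈ complexRoots P, aeval α Q = k := by
  refine ⟨resultant P Q, ?_⟩
  have h := resultant_eq_prod_eval (P.map (Int.castRingHom ℂ)) (Q.map (Int.castRingHom ℂ))
    Q.natDegree natDegree_map_le (IsAlgClosed.splits _)
  rw [(hP.map _).leadingCoeff, one_pow, one_mul, hP.natDegree_map, resultant_map_map] at h
  rw [prod_complexRoots hP hirr]
  simp only [eq_intCast] at h
  rw [h]
  congr 1
  refine Multiset.map_congr rfl fun α _ => ?_
  rw [eval_map, aeval_def]
  rfl

/-- Substitute for Galois conjugation: P is associated to the minimal polynomial of α, so it divides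
Q. -/
theorem aeval_eq_zero_of_root {P : ℤ[X]} (hP : P.Monic) (hirr : Irreducible P) {Q : ℤ[X]} {α : ℂ}
    (hα : α ∈ complexRoots P) (h : aeval α Q = 0) {β : ℂ} (hβ : β ∈ complexRoots P) :
    aeval β Q = 0 := by
  rw [mem_complexRoots hP] at hα hβ
  have hint : IsIntegral ℤ α := ⟨P, hP, by rwa [aeval_def] at hα⟩
  have h1 : minpoly ℤ α ∣ P := minpoly.isIntegrallyClosed_dvd hint hα
  have h2 : minpoly ℤ α ∣ Q := minpoly.isIntegrallyClosed_dvd hint h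
  have h3 : P ∣ minpoly ℤ α := by
    obtain ⟨c, hc⟩ := h1
    rcases hirr.isUnit_or_isUnit hc with hu | hu
    · exact absurd hu (minpoly.not_isUnit ℤ α)
    · rw [hc]; exact (hu.mul_right_dvd).2 dvd_rfl
  obtain ⟨c, hc⟩ := h3.trans h2
  rw [hc, map_mul, hβ, zero_mul]

theorem sum_log_norm_aeval_nonneg {P : ℤ[X]} (hP : P.Monic) (hirr : Irreducible P) (Q : ℤ[X])
    (h : ∀ α ∈ complexRoots P, aeval α Q ≠ 0) :
    0 ≤ ∑ α ∈ complexRoots P, Real.log ‖aeval α Q‖ := by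
  obtain ⟨k, hk⟩ := exists_int_eq_prod_aeval hP hirr Q
  rw [← Real.log_prod (fun α hα => norm_ne_zero_iff.2 (h α hα)), ← norm_prod, hk]
  have hk0 : k ≠ 0 := by
    rintro rfl
    exact Finset.prod_ne_zero_iff.2 h (by simpa using hk)
  refine Real.log_nonneg ?_
  rw [Complex.norm_intCast]
  exact_mod_cast Int.one_le_abs hk0

/-- This is |disc P| ≥ 1: the product of P'(α) over the roots is a nonzero integer. -/
theorem sum_log_norm_sub_nonneg {P : ℤ[X]} (hP : P.Monic) (hirr : Irreducible P) :
    0 ≤ ∑ α ∈ complexRoots P, ∑ β ∈ (complexRoots P).erase α, Real.log ‖α - β‖ := by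
  have hder : ∀ α ∈ complexRoots P,
      aeval α (derivative P) = ∏ β ∈ (complexRoots P).erase α, (α - β) := by
    intro α hα
    have hsp := IsAlgClosed.splits (P.map (Int.castRingHom ℂ))
    have h1 := hsp.eval_root_derivative (hP.map _) (x := α)
      (by rwa [complexRoots, Multiset.mem_toFinset] at hα)
    rw [derivative_map, eval_map] at h1
    rw [aeval_def]
    refine Eq.trans ?_ (h1.trans ?_)
    · rfl
    · rw [Finset.prod, Finset.erase_val, complexRoots, Multiset.toFinset_val,
        (nodup_roots_map hP hirr).dedup]
  have h := sum_log_norm_aeval_nonneg hP hirr (derivative P) (fun α hα => by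
    rw [hder α hα]
    exact Finset.prod_ne_zero_iff.2 fun β hβ => sub_ne_zero.2 (Finset.ne_of_mem_erase hβ).symm)
  refine h.trans (le_of_eq (Finset.sum_congr rfl fun α hα => ?_))
  rw [hder α hα, norm_prod, Real.log_prod]
  exact fun β hβ => norm_ne_zero_iff.2 (sub_ne_zero.2 (Finset.ne_of_mem_erase hβ).symm)

/-- The monic integer polynomial whose roots are the `q`-th powers of the roots of `P`. -/
noncomputable def powRoots (P : ℤ[X]) (q : ℕ) : ℤ[X] :=
  resultant (P.map C) (C X - X ^ q) P.natDegree q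

theorem aeval_powRoots {P : ℤ[X]} (hP : P.Monic) (hirr : Irreducible P) {q : ℕ} (a : ℂ) :
    aeval a (powRoots P q) = ∏ β ∈ complexRoots P, (a - β ^ q) := by
  have h := resultant_eq_prod_eval (P.map (Int.castRingHom ℂ)) (C a - X ^ q)
    q (by compute_degree) (IsAlgClosed.splits _)
  rw [(hP.map _).leadingCoeff, one_pow, one_mul, hP.natDegree_map] at h
  rw [prod_complexRoots hP hirr]
  have h2 := resultant_map_map (P.map (C : ℤ →+* ℤ[X])) (C X - X ^ q) P.natDegree q
    (aeval a : ℤ[X] →ₐ[ℤ] ℂ).toRingHom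
  rw [Polynomial.map_map, RingHom.ext_int ((aeval a : ℤ[X] →ₐ[ℤ] ℂ).toRingHom.comp C)
    (Int.castRingHom ℂ)] at h2
  have e : (C X - X ^ q : ℤ[X][X]).map (aeval a : ℤ[X] →ₐ[ℤ] ℂ).toRingHom = C a - X ^ q := by
    simp
  rw [e, h] at h2
  simpa [powRoots] using h2.symm

/-- A root of largest modulus. -/
theorem exists_max_root {P : ℤ[X]} (hP : P.Monic) (hirr : Irreducible P)
    (hM : 1 < (P.map (Int.castRingHom ℂ)).mahlerMeasure) :
    ∃ α ∈ complexRoots P, 1 < ‖α‖ ∧ ∀ β ∈ complexRoots P, ‖β‖ ≤ ‖α‖ := by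
  have hlog := Real.log_pos hM
  rw [log_mahlerMeasure_eq hP hirr] at hlog
  obtain ⟨γ, hγ, hγ1⟩ := Finset.exists_lt_of_sum_lt (f := fun _ => (0 : ℝ))
    (s := complexRoots P) (by simpa using hlog)
  obtain ⟨α, hα, hmax⟩ := Finset.exists_max_image (complexRoots P) (fun z => ‖z‖) ⟨γ, hγ⟩
  refine ⟨α, hα, ?_, hmax⟩
  have : 1 < ‖γ‖ := by
    by_contra h
    rw [(Real.posLog_eq_zero_iff _).2 (by rw [abs_of_nonneg (norm_nonneg _)]; linarith)] at hγ1
    exact hγ1.false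
  exact this.trans_le (hmax γ hγ)

theorem pow_ne_pow_of_roots {P : ℤ[X]} (hP : P.Monic) (hirr : Irreducible P)
    (hM : 1 < (P.map (Int.castRingHom ℂ)).mahlerMeasure) {p q : ℕ} (hpq : p ≠ q)
    {α β : ℂ} (hα : α ∈ complexRoots P) (hβ : β ∈ complexRoots P) : α ^ p ≠ β ^ q := by
  wlog hlt : q < p generalizing p q α β
  · exact (this hpq.symm hβ hα (lt_of_le_of_ne (not_lt.1 hlt) hpq)).symm
  intro h
  -- The relation is algebraic, so it transfers to the root γ of largest modulus: γ^p = δ^q for some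
  -- root δ. This is impossible for q < p, since |δ| ≤ |γ| and |γ| > 1.
  obtain ⟨γ, hγ, hγ1, hmax⟩ := exists_max_root hP hirr hM
  have h0 : aeval α ((powRoots P q).comp (X ^ p)) = 0 := by
    rw [aeval_comp, aeval_X_pow, aeval_powRoots hP hirr]
    exact Finset.prod_eq_zero hβ (sub_eq_zero.2 h)
  have h1 := aeval_eq_zero_of_root hP hirr hα h0 hγ
  rw [aeval_comp, aeval_X_pow, aeval_powRoots hP hirr, Finset.prod_eq_zero_iff] at h1
  obtain ⟨δ, hδ, hδ1⟩ := h1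
  have h2 : ‖γ‖ ^ p = ‖δ‖ ^ q := by rw [← norm_pow, ← norm_pow, sub_eq_zero.1 hδ1]
  have h3 : ‖δ‖ ^ q ≤ ‖γ‖ ^ q := pow_le_pow_left₀ (norm_nonneg _) (hmax δ hδ) _
  have h4 : ‖γ‖ ^ q < ‖γ‖ ^ p := pow_lt_pow_right₀ hγ1 hlt
  linarith

theorem pow_ne_one_of_root {P : ℤ[X]} (hP : P.Monic) (hirr : Irreducible P)
    (hM : 1 < (P.map (Int.castRingHom ℂ)).mahlerMeasure) {n : ℕ} (hn : n ≠ 0)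
    {α : ℂ} (hα : α ∈ complexRoots P) : α ^ n ≠ 1 := by
  simpa using pow_ne_pow_of_roots hP hirr hM hn hα hα (q := 0)

theorem sum_log_norm_pow_sub_pow_nonneg {P : ℤ[X]} (hP : P.Monic) (hirr : Irreducible P)
    (hM : 1 < (P.map (Int.castRingHom ℂ)).mahlerMeasure) {p q : ℕ} (hpq : p ≠ q) :
    0 ≤ ∑ α ∈ complexRoots P, ∑ β ∈ complexRoots P, Real.log ‖α ^ p - β ^ q‖ := by
  have key : ∀ α : ℂ, aeval α ((powRoots P q).comp (X ^ p))
      = ∏ β ∈ complexRoots P, (α ^ p - β ^ q) := fun α => by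
    rw [aeval_comp, aeval_X_pow, aeval_powRoots hP hirr]
  have hne : ∀ α ∈ complexRoots P, ∀ β ∈ complexRoots P, α ^ p - β ^ q ≠ 0 :=
    fun α hα β hβ => sub_ne_zero.2 (pow_ne_pow_of_roots hP hirr hM hpq hα hβ)
  refine (sum_log_norm_aeval_nonneg hP hirr ((powRoots P q).comp (X ^ p)) fun α hα => by
    rw [key]; exact Finset.prod_ne_zero_iff.2 (hne α hα)).trans (le_of_eq ?_)
  refine Finset.sum_congr rfl fun α hα => ?_
  rw [key, norm_prod, Real.log_prod fun β hβ => norm_ne_zero_iff.2 (hne α hα β hβ)]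

theorem exists_expand_eq_pow_add (P : ℤ[X]) {p : ℕ} (hp : p.Prime) :
    ∃ Q : ℤ[X], P.comp (X ^ p) = P ^ p + C (p : ℤ) * Q := by
  have := Fact.mk hp
  have h : (P.comp (X ^ p) - P ^ p).map (Int.castRingHom (ZMod p)) = 0 := by
    rw [Polynomial.map_sub, Polynomial.map_pow, ← ZMod.expand_card, ← map_expand,
      expand_eq_comp_X_pow, sub_self]
  have h2 : C (p : ℤ) ∣ P.comp (X ^ p) - P ^ p := by
    rw [C_dvd_iff_dvd_coeff]
    intro i
    have := congrArg (fun f => coeff f i) h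
    simp only [coeff_map, coeff_zero, eq_intCast] at this
    exact (ZMod.intCast_zmod_eq_zero_iff_dvd _ _).1 this
  obtain ⟨Q, hQ⟩ := h2
  exact ⟨Q, by rw [← hQ]; ring⟩

theorem aeval_eq_prod {P : ℤ[X]} (hP : P.Monic) (hirr : Irreducible P) (a : ℂ) :
    aeval a P = ∏ β ∈ complexRoots P, (a - β) := by
  have h := (IsAlgClosed.splits (P.map (Int.castRingHom ℂ))).eq_prod_roots_of_monic (hP.map _)
  have h1 : aeval a P = eval a (P.map (Int.castRingHom ℂ)) := by rw [eval_map, aeval_def]; rfl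
  rw [h1, h, eval_multiset_prod, prod_complexRoots hP hirr, Multiset.map_map]
  simp

/-- At a root α the congruence P(x^p) ≡ P(x)^p mod p reads P(α^p) = p·Q(α). The product over the
roots is therefore p^d times a nonzero integer; this is Dobrowolski's gain. -/
theorem card_mul_log_prime_le {P : ℤ[X]} (hP : P.Monic) (hirr : Irreducible P)
    (hM : 1 < (P.map (Int.castRingHom ℂ)).mahlerMeasure) {p : ℕ} (hp : p.Prime) :
    P.natDegree * Real.log p
      ≤ ∑ α ∈ complexRoots P, ∑ β ∈ complexRoots P, Real.log ‖α ^ p - β‖ := by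
  have hne : ∀ α ∈ complexRoots P, ∀ β ∈ complexRoots P, α ^ p - β ≠ 0 :=
    fun α hα β hβ => sub_ne_zero.2 (by
      simpa using pow_ne_pow_of_roots hP hirr hM hp.ne_one hα hβ)
  obtain ⟨Q, hQ⟩ := exists_expand_eq_pow_add P hp
  have hp0 : (p : ℂ) ≠ 0 := Nat.cast_ne_zero.2 hp.ne_zero
  have key : ∀ α ∈ complexRoots P, (p : ℂ) * aeval α Q = ∏ β ∈ complexRoots P, (α ^ p - β) := by
    intro α hα
    have h1 := congrArg (aeval α) hQ
    rw [aeval_comp, aeval_X_pow, aeval_eq_prod hP hirr, map_add, map_pow,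
      (mem_complexRoots hP).1 hα, zero_pow hp.ne_zero, zero_add] at h1
    rw [h1]
    simp
  have hQ0 : ∀ α ∈ complexRoots P, aeval α Q ≠ 0 := fun α hα h0 => by
    have := key α hα
    rw [h0, mul_zero] at this
    exact Finset.prod_ne_zero_iff.2 (hne α hα) this.symm
  have h := sum_log_norm_aeval_nonneg hP hirr Q hQ0
  calc (P.natDegree : ℝ) * Real.log p
      ≤ ∑ α ∈ complexRoots P, (Real.log p + Real.log ‖aeval α Q‖) := by
        rw [Finset.sum_add_distrib, Finset.sum_const, card_complexRoots hP hirr, nsmul_eq_mul]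
        linarith
    _ = _ := Finset.sum_congr rfl fun α hα => by
        rw [← Real.log_prod (fun β hβ => norm_ne_zero_iff.2 (hne α hα β hβ)), ← norm_prod,
          ← key α hα, norm_mul, Complex.norm_natCast,
          Real.log_mul (by exact_mod_cast hp.ne_zero) (norm_ne_zero_iff.2 (hQ0 α hα))]

end

/-! ### A lower bound for the Mahler measure -/

section

open Polynomial

/-- The regularised energy between the `a`-th and the `b`-th powers of the roots of `P`. -/
noncomputable def rootKernel (P : ℤ[X]) (r : ℝ) (a b : ℕ) : ℝ :=
  ∑ α ∈ complexRoots P, ∑ β ∈ complexRoots P,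
    Real.log ‖1 - r * (discReflect α ^ a * (starRingEnd ℂ) (discReflect β ^ b))‖

theorem rootKernel_comm (P : ℤ[X]) (r : ℝ) (a b : ℕ) :
    rootKernel P r a b = rootKernel P r b a := by
  rw [rootKernel, rootKernel, Finset.sum_comm]
  refine Finset.sum_congr rfl fun α _ => Finset.sum_congr rfl fun β _ => ?_
  rw [← RCLike.norm_conj]
  congr 2
  simp only [map_sub, map_mul, map_one, map_pow, Complex.conj_ofReal, Complex.conj_conj]
  ring

theorem posLog_norm_pow (z : ℂ) (n : ℕ) : Real.posLog ‖z ^ n‖ = n * Real.posLog ‖z‖ := by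
  rw [norm_pow]
  rcases le_or_gt ‖z‖ 1 with h | h
  · rw [(Real.posLog_eq_zero_iff (‖z‖ ^ n)).2 (by
        rw [abs_of_nonneg (by positivity)]; exact pow_le_one₀ (norm_nonneg _) h),
      (Real.posLog_eq_zero_iff ‖z‖).2 (by rw [abs_of_nonneg (norm_nonneg _)]; exact h), mul_zero]
  · rw [Real.posLog_eq_log (x := ‖z‖ ^ n) (by
        rw [abs_of_nonneg (by positivity)]; exact one_le_pow₀ h.le),
      Real.posLog_eq_log (x := ‖z‖) (by rw [abs_of_nonneg (norm_nonneg _)]; exact h.le),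
      Real.log_pow]

variable {P : ℤ[X]} (hP : P.Monic) (hirr : Irreducible P)
  (hM : 1 < (P.map (Int.castRingHom ℂ)).mahlerMeasure)

-- Passage from the arithmetic sums to the energy: regularisation costs 1 - r for each of the d²
-- pairs, and reflecting exterior roots costs log⁺ terms that add up to multiples of log M(P).
include hP hirr hM in
theorem sum_log_norm_pow_sub_pow_le_rootKernel {a b : ℕ} (ha : a ≠ 0) (hb : b ≠ 0) (hab : a ≠ b)
    {r : ℝ} (hr0 : 0 ≤ r) (hr1 : r ≤ 1) :
    ∑ α ∈ complexRoots P, ∑ β ∈ complexRoots P, Real.log ‖α ^ a - β ^ b‖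
      ≤ rootKernel P r a b + P.natDegree * (P.natDegree * (1 - r) +
        (a + b) * Real.log (P.map (Int.castRingHom ℂ)).mahlerMeasure) := by
  have hc := card_complexRoots hP hirr
  calc _ ≤ ∑ α ∈ complexRoots P, ∑ β ∈ complexRoots P,
        (Real.log ‖1 - r * (discReflect α ^ a * (starRingEnd ℂ) (discReflect β ^ b))‖
          + (1 - r) + a * Real.posLog ‖α‖ + b * Real.posLog ‖β‖) := by
        refine Finset.sum_le_sum fun α hα => Finset.sum_le_sum fun β hβ => ?_
        have := log_norm_sub_le_kernel (pow_ne_pow_of_roots hP hirr hM hab hα hβ) hr0 hr1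
        rwa [discReflect_pow _ ha, discReflect_pow _ hb, posLog_norm_pow, posLog_norm_pow] at this
    _ = _ := by
        simp only [Finset.sum_add_distrib, Finset.sum_const, ← Finset.mul_sum, hc, nsmul_eq_mul,
          rootKernel, log_mahlerMeasure_eq hP hirr]
        ring

include hP hirr in
theorem rootKernel_one_one_ge {r : ℝ} (hr0 : 0 ≤ r) (hr1 : r < 1) :
    -(P.natDegree * (-Real.log (1 - r) + P.natDegree * (1 - r) +
      2 * Real.log (P.map (Int.castRingHom ℂ)).mahlerMeasure)) ≤ rootKernel P r 1 1 := by
  have hc := card_complexRoots hP hirr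
  have h0 := sum_log_norm_sub_nonneg hP hirr
  have h1 : ∑ α ∈ complexRoots P, ∑ β ∈ (complexRoots P).erase α, Real.log ‖α - β‖
      ≤ ∑ α ∈ complexRoots P, (∑ β ∈ complexRoots P,
        (Real.log ‖1 - r * (discReflect α * (starRingEnd ℂ) (discReflect β))‖
          + (1 - r) + Real.posLog ‖α‖ + Real.posLog ‖β‖) - Real.log (1 - r)) := by
    refine Finset.sum_le_sum fun α hα => ?_
    rw [← Finset.add_sum_erase _ _ hα]
    have e1 : ∑ β ∈ (complexRoots P).erase α, Real.log ‖α - β‖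
        ≤ ∑ β ∈ (complexRoots P).erase α,
        (Real.log ‖1 - r * (discReflect α * (starRingEnd ℂ) (discReflect β))‖
          + (1 - r) + Real.posLog ‖α‖ + Real.posLog ‖β‖) :=
      Finset.sum_le_sum fun β hβ =>
        log_norm_sub_le_kernel (Finset.ne_of_mem_erase hβ).symm hr0 hr1.le
    have e2 : ‖discReflect α * (starRingEnd ℂ) (discReflect α)‖ ≤ 1 := by
      rw [norm_mul, RCLike.norm_conj]
      exact mul_le_one₀ (norm_discReflect_le_one α) (norm_nonneg _) (norm_discReflect_le_one α)
    have e3 := log_one_sub_le_log_norm e2 hr0 hr1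
    have e4 := Real.posLog_nonneg (x := ‖α‖)
    linarith
  have h2 := h0.trans h1
  simp only [Finset.sum_sub_distrib, Finset.sum_add_distrib, Finset.sum_const, ← Finset.mul_sum,
    hc, nsmul_eq_mul, ← log_mahlerMeasure_eq hP hirr] at h2
  have h3 : rootKernel P r 1 1 = ∑ α ∈ complexRoots P, ∑ β ∈ complexRoots P,
      Real.log ‖1 - r * (discReflect α * (starRingEnd ℂ) (discReflect β))‖ := by
    simp [rootKernel]
  rw [h3]
  linarith

theorem sum_rootKernel_nonpos (P : ℤ[X]) (E : Finset ℕ) (t : ℕ → ℝ) {r : ℝ} (hr0 : 0 ≤ r)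
    (hr1 : r < 1) : ∑ a ∈ E, ∑ b ∈ E, t a * t b * rootKernel P r a b ≤ 0 := by
  have h := energy_nonneg (E ×ˢ complexRoots P) (fun i => t i.1) (fun i => discReflect i.2 ^ i.1)
    (fun i _ => by
      rw [norm_pow]; exact pow_le_one₀ (norm_nonneg _) (norm_discReflect_le_one _)) hr0 hr1
  refine le_trans (le_of_eq ?_) h
  rw [Finset.sum_product]
  refine Finset.sum_congr rfl fun a _ => ?_
  simp only [Finset.sum_product, rootKernel, Finset.mul_sum]
  rw [Finset.sum_comm]

/-- The energy of the `a`-th powers of the roots, as a series supported on the multiples of `a`. -/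
theorem hasSum_rootKernel (P : ℤ[X]) {a : ℕ} (ha : 0 < a) {r : ℝ} (hr0 : 0 ≤ r) (hr1 : r < 1) :
    HasSum (fun l : ℕ => if a ∣ l then a * r ^ (l / a) / l *
      ‖∑ α ∈ complexRoots P, discReflect α ^ l‖ ^ 2 else 0) (-rootKernel P r a a) := by
  have h := hasSum_energy (complexRoots P) (fun _ => 1) (fun α => discReflect α ^ a)
    (fun i _ => by
      rw [norm_pow]; exact pow_le_one₀ (norm_nonneg _) (norm_discReflect_le_one _)) hr0 hr1
  rw [← (mul_right_injective₀ ha.ne').hasSum_iff (g := fun n : ℕ => a * n)]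
  · convert! h using 1
    · funext n
      have ha' : (a : ℝ) ≠ 0 := by exact_mod_cast ha.ne'
      simp only [Function.comp, dvd_mul_right, if_true, Nat.mul_div_cancel_left _ ha,
        Complex.ofReal_one, one_mul, ← pow_mul]
      push_cast
      rw [mul_div_mul_left _ _ ha']
    · simp [rootKernel]
  · intro l hl
    rw [if_neg]
    rintro ⟨c, rfl⟩
    exact hl ⟨c, rfl⟩

theorem card_mul_log_two_le {S : Finset ℕ} (hS : ∀ p ∈ S, p.Prime) {l : ℕ} (hl : l ≠ 0) :
    ((S.filter (· ∣ l)).card : ℝ) * Real.log 2 ≤ Real.log l := by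
  have h1 : S.filter (· ∣ l) ⊆ l.primeFactors := fun p hp => by
    rw [Finset.mem_filter] at hp
    exact Nat.mem_primeFactors.2 ⟨hS p hp.1, hp.2, hl⟩
  have h2 : 2 ^ (S.filter (· ∣ l)).card ≤ l :=
    calc 2 ^ (S.filter (· ∣ l)).card ≤ 2 ^ l.primeFactors.card :=
          Nat.pow_le_pow_right two_pos (Finset.card_le_card h1)
      _ ≤ ∏ p ∈ l.primeFactors, p := Finset.pow_card_le_prod _ _ _ fun p hp =>
          (Nat.prime_of_mem_primeFactors hp).two_le
      _ ≤ l := Nat.le_of_dvd (Nat.pos_of_ne_zero hl) (Nat.prod_primeFactors_dvd l)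
  rw [← Real.log_pow]
  exact Real.log_le_log (by positivity) (by exact_mod_cast h2)

/-- An integer l may have up to about log l prime divisors; the geometric factor absorbs this count.
The proof combines log x ≤ x - 1 at x = l(1 - ρ) with Bernoulli's inequality for (2 - ρ)^l and ρ(2 -
ρ) ≤ 1. -/
theorem pow_mul_log_le {ρ : ℝ} (hρ0 : 0 ≤ ρ) (hρ1 : ρ < 1) {l : ℕ} (hl : l ≠ 0) :
    ρ ^ l * Real.log l ≤ 1 - Real.log (1 - ρ) := by
  have hl' : (0 : ℝ) < l := by exact_mod_cast Nat.pos_of_ne_zero hl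
  have h1ρ : 0 < 1 - ρ := by linarith
  have h1 : Real.log l ≤ l * (1 - ρ) - Real.log (1 - ρ) := by
    have := Real.log_le_sub_one_of_pos (mul_pos hl' h1ρ)
    rw [Real.log_mul hl'.ne' h1ρ.ne'] at this
    linarith
  have h2 : ρ ^ l ≤ 1 := pow_le_one₀ hρ0 hρ1.le
  have h3 : ρ ^ l * (1 + l * (1 - ρ)) ≤ 1 := by
    have hb := one_add_mul_le_pow (show (-2 : ℝ) ≤ 1 - ρ by linarith) l
    calc ρ ^ l * (1 + l * (1 - ρ)) ≤ ρ ^ l * (1 + (1 - ρ)) ^ l :=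
          mul_le_mul_of_nonneg_left hb (by positivity)
      _ = (ρ * (1 + (1 - ρ))) ^ l := by rw [mul_pow]
      _ ≤ 1 := pow_le_one₀ (by nlinarith) (by nlinarith [sq_nonneg (1 - ρ)])
  have h4 : 0 ≤ -Real.log (1 - ρ) := by
    have := Real.log_nonpos h1ρ.le (by linarith)
    linarith
  have h5 : 0 ≤ ρ ^ l := by positivity
  calc ρ ^ l * Real.log l ≤ ρ ^ l * (l * (1 - ρ) - Real.log (1 - ρ)) :=
        mul_le_mul_of_nonneg_left h1 h5
    _ = ρ ^ l * (1 + l * (1 - ρ)) - ρ ^ l + ρ ^ l * (-Real.log (1 - ρ)) := by ring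
    _ ≤ 1 - Real.log (1 - ρ) := by nlinarith

/-- Averaging over primes, the energies of the prime powers of the roots are controlled by the
energy of the roots. -/
theorem sum_prime_rootKernel_ge (P : ℤ[X]) {S : Finset ℕ} {X : ℕ} (hS : ∀ p ∈ S, p.Prime)
    (hSX : ∀ p ∈ S, p ≤ X) {ρ : ℝ} (hρ0 : 0 ≤ ρ) (hρ1 : ρ < 1) (hX : X ≠ 0) :
    X * (2 * (1 - Real.log (1 - ρ))) * rootKernel P ρ 1 1
      ≤ ∑ p ∈ S, rootKernel P (ρ ^ (2 * X)) p p := by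
  have hr0 : 0 ≤ ρ ^ (2 * X) := by positivity
  have hr1 : ρ ^ (2 * X) < 1 := pow_lt_one₀ hρ0 hρ1 (by omega)
  have h1 := hasSum_sum (fun p hp => hasSum_rootKernel P (hS p hp).pos hr0 hr1)
  have h2 := (hasSum_rootKernel P one_pos hρ0 hρ1).mul_left (X * (2 * (1 - Real.log (1 - ρ))))
  have h3 := hasSum_le (fun l => ?_) h1 h2
  · rw [Finset.sum_neg_distrib] at h3
    linarith
  · rcases eq_or_ne l 0 with rfl | hl
    · simp
    simp only [one_dvd, if_true, Nat.div_one, Nat.cast_one, one_mul]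
    rw [← Finset.sum_filter]
    have hl' : (0 : ℝ) < l := by exact_mod_cast Nat.pos_of_ne_zero hl
    set f := ‖∑ α ∈ complexRoots P, discReflect α ^ l‖ ^ 2
    have hf : 0 ≤ f := by positivity
    have hterm : ∀ p ∈ S.filter (· ∣ l), (p : ℝ) * (ρ ^ (2 * X)) ^ (l / p) / l * f
        ≤ X * (ρ ^ l * ρ ^ l) / l * f := by
      intro p hp
      rw [Finset.mem_filter] at hp
      have hpX : (p : ℝ) ≤ X := by exact_mod_cast hSX p hp.1
      -- Since 2X·(l/p) ≥ 2l, there are two factors ρ^l: one absorbs the number of primes dividing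
      -- l, the other rebuilds the energy at ρ.
      have hpow : (ρ ^ (2 * X)) ^ (l / p) ≤ ρ ^ l * ρ ^ l := by
        rw [← pow_mul, ← pow_add]
        refine pow_le_pow_of_le_one hρ0 hρ1.le ?_
        have e := Nat.mul_div_cancel' hp.2
        have := Nat.mul_le_mul_right (l / p) (hSX p hp.1)
        nlinarith
      gcongr
    refine (Finset.sum_le_sum hterm).trans ?_
    rw [Finset.sum_const, nsmul_eq_mul]
    have hω := card_mul_log_two_le hS hl
    have hlog2 : (1 / 2 : ℝ) ≤ Real.log 2 := by linarith [Real.log_two_gt_d9]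
    have hω2 : ((S.filter (· ∣ l)).card : ℝ) * ρ ^ l ≤ 2 * (1 - Real.log (1 - ρ)) := by
      have h5 := pow_mul_log_le hρ0 hρ1 hl
      have h6 : ((S.filter (· ∣ l)).card : ℝ) ≤ 2 * Real.log l := by
        have : (0 : ℝ) ≤ ((S.filter (· ∣ l)).card : ℝ) := by positivity
        nlinarith
      have h7 : 0 ≤ ρ ^ l := by positivity
      nlinarith
    calc ((S.filter (· ∣ l)).card : ℝ) * (X * (ρ ^ l * ρ ^ l) / l * f)
        = (((S.filter (· ∣ l)).card : ℝ) * ρ ^ l) * (X * (ρ ^ l / l * f)) := by ring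
      _ ≤ (2 * (1 - Real.log (1 - ρ))) * (X * (ρ ^ l / l * f)) :=
          mul_le_mul_of_nonneg_right hω2 (by positivity)
      _ = _ := by ring

end

/-! ### A Dobrowolski-type bound from the quadratic form in the prime powers -/

section

open Polynomial

-- Positivity of the energy with weight T on exponent 1 and weight 1 on each prime p ≤ N. The cross
-- terms (p, 1) give dθ(N); every other block is bounded below by an integrality argument or by
-- averaging, and a factor d cancels at the end.
set_option maxHeartbeats 1000000 in
theorem two_mul_theta_le {P : ℤ[X]} (hP : P.Monic) (hirr : Irreducible P)
    (hM : 1 < (P.map (Int.castRingHom ℂ)).mahlerMeasure) {N : ℕ} (hN : 1 ≤ N)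
    (hd : 1 ≤ P.natDegree)
    (hℓ : Real.log (P.map (Int.castRingHom ℂ)).mahlerMeasure ≤ 1 / (N : ℝ) ^ 3)
    {T : ℝ} (hT : 0 ≤ T) :
    2 * T * Chebyshev.theta N ≤ T ^ 2 * (Real.log (P.natDegree * (N : ℝ) ^ 3) + 4) + 8 * T + 4 +
      2 * N * (1 + Real.log (P.natDegree * (N : ℝ) ^ 3)) *
        (Real.log (P.natDegree * (N : ℝ) ^ 3) + 4) := by
  set ℓ := Real.log (P.map (Int.castRingHom ℂ)).mahlerMeasure with hℓdef
  set L := Real.log (P.natDegree * (N : ℝ) ^ 3) with hL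
  set d : ℝ := (P.natDegree : ℝ) with hd'
  have hd1 : 1 ≤ d := by rw [hd']; exact_mod_cast hd
  have hN1 : (1 : ℝ) ≤ N := by exact_mod_cast hN
  have hN3 : (1 : ℝ) ≤ (N : ℝ) ^ 3 := one_le_pow₀ hN1
  have hℓ0 : 0 ≤ ℓ := (Real.log_pos hM).le
  have hdN : 1 ≤ d * (N : ℝ) ^ 3 := one_le_mul_of_one_le_of_one_le hd1 hN3
  have hL0 : 0 ≤ L := Real.log_nonneg hdN
  -- With this ρ and r = ρ^(2N), both d(1 - r) and (p + q)ℓ are at most e = 2/N². Each pair of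
  -- exponents then costs at most 2ed, so all off-diagonal prime pairs together cost at most 4d.
  set ρ : ℝ := 1 - (d * (N : ℝ) ^ 3)⁻¹ with hρ
  have hinv : (d * (N : ℝ) ^ 3)⁻¹ ≤ 1 := inv_le_one_of_one_le₀ hdN
  have hinv0 : 0 < (d * (N : ℝ) ^ 3)⁻¹ := by positivity
  have hρ0 : 0 ≤ ρ := by rw [hρ]; linarith
  have hρ1 : ρ < 1 := by rw [hρ]; linarith
  have h1ρ : 1 - ρ = (d * (N : ℝ) ^ 3)⁻¹ := by rw [hρ]; ring
  have hlogρ : Real.log (1 - ρ) = -L := by rw [h1ρ, Real.log_inv]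
  set r : ℝ := ρ ^ (2 * N) with hr
  have hr0 : 0 ≤ r := by positivity
  have hr1 : r < 1 := pow_lt_one₀ hρ0 hρ1 (by omega)
  have hrρ : r ≤ ρ := pow_le_of_le_one hρ0 hρ1.le (by omega)
  have hlogr : -Real.log (1 - r) ≤ L := by
    have := Real.log_le_log (by linarith : 0 < 1 - ρ) (by linarith : 1 - ρ ≤ 1 - r)
    linarith
  set e : ℝ := 2 / (N : ℝ) ^ 2 with he
  have he2 : e ≤ 2 := by
    rw [he, div_le_iff₀ (by positivity)]; nlinarith [one_le_pow₀ hN1 (n := 2)]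
  have hNe : N * e ≤ 2 := by
    rw [he, mul_div_assoc', div_le_iff₀ (by positivity)]; nlinarith
  have hNNe : (N : ℝ) ^ 2 * e = 2 := by rw [he]; field_simp
  have hdρ : d * (1 - ρ) ≤ 1 / (N : ℝ) ^ 3 := by
    rw [h1ρ, mul_inv, mul_inv_cancel_left₀ (by positivity), one_div]
  have h2N3 : 2 * N * (1 / (N : ℝ) ^ 3) = e := by rw [he]; field_simp
  have h13 : 0 ≤ 1 / (N : ℝ) ^ 3 := by positivity
  have hdr : d * (1 - r) ≤ e := by
    have hb := one_add_mul_le_pow (show (-2 : ℝ) ≤ -(1 - ρ) by linarith) (2 * N)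
    have : 1 - r ≤ 2 * N * (1 - ρ) := by
      rw [show 1 + -(1 - ρ) = ρ by ring] at hb
      push_cast at hb
      linarith
    calc d * (1 - r) ≤ d * (2 * N * (1 - ρ)) := by gcongr
      _ = 2 * N * (d * (1 - ρ)) := by ring
      _ ≤ 2 * N * (1 / (N : ℝ) ^ 3) := by gcongr
      _ = e := h2N3
  have hsmall : ∀ x : ℝ, x ≤ 2 * N → x * ℓ ≤ e := fun x hx => by
    calc x * ℓ ≤ 2 * N * ℓ := by gcongr
      _ ≤ 2 * N * (1 / (N : ℝ) ^ 3) := by gcongr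
      _ = e := h2N3
  have h13e : 1 / (N : ℝ) ^ 3 ≤ e := by rw [← h2N3]; nlinarith
  set S := Nat.primesLE N with hS
  have hSp : ∀ p ∈ S, p.Prime := fun p hp => (Nat.mem_primesLE.1 hp).2
  have hSN : ∀ p ∈ S, p ≤ N := fun p hp => (Nat.mem_primesLE.1 hp).1
  have hcard : (S.card : ℝ) ≤ N := by
    have : S ⊆ Finset.Icc 1 N := fun p hp => Finset.mem_Icc.2 ⟨(hSp p hp).one_le, hSN p hp⟩
    have := Finset.card_le_card this
    rw [Nat.card_Icc, Nat.add_sub_cancel] at this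
    exact_mod_cast this
  have h1S : 1 ∉ S := fun h => Nat.not_prime_one (hSp 1 h)
  have hpos := sum_rootKernel_nonpos P (insert 1 S) (fun a => if a = 1 then T else 1) hr0 hr1
  have hne1 : ∀ p ∈ S, p ≠ 1 := fun p hp => (hSp p hp).ne_one
  have hexp : ∑ a ∈ insert 1 S, ∑ b ∈ insert 1 S, (if a = 1 then T else 1) *
      (if b = 1 then T else 1) * rootKernel P r a b
      = T ^ 2 * rootKernel P r 1 1 + 2 * T * ∑ p ∈ S, rootKernel P r p 1 +
        (∑ p ∈ S, rootKernel P r p p + ∑ p ∈ S, ∑ q ∈ S.erase p, rootKernel P r p q) := by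
    rw [Finset.sum_insert h1S, Finset.sum_insert h1S]
    have e1 : ∑ b ∈ S, (if 1 = 1 then T else 1) * (if b = 1 then T else 1) * rootKernel P r 1 b
        = T * ∑ p ∈ S, rootKernel P r p 1 := by
      rw [Finset.mul_sum]
      exact Finset.sum_congr rfl fun p hp => by
        rw [if_neg (hne1 p hp), if_pos rfl, rootKernel_comm]; ring
    have e2 : ∑ a ∈ S, ∑ b ∈ insert 1 S, (if a = 1 then T else 1) *
        (if b = 1 then T else 1) * rootKernel P r a b
        = T * ∑ p ∈ S, rootKernel P r p 1 +
        (∑ p ∈ S, rootKernel P r p p + ∑ p ∈ S, ∑ q ∈ S.erase p, rootKernel P r p q) := by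
      rw [Finset.mul_sum, ← Finset.sum_add_distrib, ← Finset.sum_add_distrib]
      refine Finset.sum_congr rfl fun p hp => ?_
      rw [Finset.sum_insert h1S, Finset.add_sum_erase _ _ hp, if_neg (hne1 p hp), if_pos rfl]
      congr 1
      · ring
      · exact Finset.sum_congr rfl fun q hq => by rw [if_neg (hne1 q hq)]; ring
    rw [e1, e2]
    simp only [if_true]
    ring
  rw [hexp] at hpos
  have hK11 : -(d * (L + 2 * e)) ≤ rootKernel P r 1 1 := by
    refine le_trans ?_ (rootKernel_one_one_ge hP hirr hr0 hr1)
    have := hsmall 2 (by linarith)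
    refine neg_le_neg (mul_le_mul_of_nonneg_left ?_ (by linarith))
    linarith
  have hK11' : -(d * (L + 2 * e)) ≤ rootKernel P ρ 1 1 := by
    refine le_trans ?_ (rootKernel_one_one_ge hP hirr hρ0 hρ1)
    have := hsmall 2 (by linarith)
    refine neg_le_neg (mul_le_mul_of_nonneg_left ?_ (by linarith))
    linarith
  have hKp1 : ∀ p ∈ S, d * Real.log p - d * (2 * e) ≤ rootKernel P r p 1 := fun p hp => by
    have h1 := card_mul_log_prime_le hP hirr hM (hSp p hp)
    have h2 := sum_log_norm_pow_sub_pow_le_rootKernel hP hirr hM (hSp p hp).ne_zero one_ne_zero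
      (hSp p hp).ne_one hr0 hr1.le
    simp only [pow_one, Nat.cast_one] at h2
    have hpN : (p : ℝ) ≤ N := by exact_mod_cast hSN p hp
    have h3 := hsmall (p + 1) (by linarith)
    have h4 : d * (d * (1 - r) + (p + 1) * ℓ) ≤ d * (2 * e) :=
      mul_le_mul_of_nonneg_left (by linarith) (by linarith)
    linarith
  have hKpq : ∀ p ∈ S, ∀ q ∈ S.erase p, -(d * (2 * e)) ≤ rootKernel P r p q := fun p hp q hq => by
    have hqS := Finset.mem_of_mem_erase hq
    have hpq := (Finset.ne_of_mem_erase hq).symm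
    have h1 := sum_log_norm_pow_sub_pow_nonneg hP hirr hM hpq
    have h2 := sum_log_norm_pow_sub_pow_le_rootKernel hP hirr hM (hSp p hp).ne_zero
      (hSp q hqS).ne_zero hpq hr0 hr1.le
    have hpN : (p : ℝ) ≤ N := by exact_mod_cast hSN p hp
    have hqN : (q : ℝ) ≤ N := by exact_mod_cast hSN q hqS
    have h3 := hsmall (p + q) (by linarith)
    have h4 : d * (d * (1 - r) + (p + q) * ℓ) ≤ d * (2 * e) :=
      mul_le_mul_of_nonneg_left (by linarith) (by linarith)
    linarith
  have hsum1 : d * Chebyshev.theta N - d * 4 ≤ ∑ p ∈ S, rootKernel P r p 1 := by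
    refine le_trans ?_ (Finset.sum_le_sum hKp1)
    rw [Finset.sum_sub_distrib, ← Finset.mul_sum, Chebyshev.theta_eq_sum_primesLE_log,
      Finset.sum_const, nsmul_eq_mul]
    have : (S.card : ℝ) * (d * (2 * e)) ≤ d * 4 := by
      calc (S.card : ℝ) * (d * (2 * e)) ≤ N * (d * (2 * e)) := by gcongr
        _ = d * (2 * (N * e)) := by ring
        _ ≤ d * (2 * 2) := by gcongr
        _ = d * 4 := by ring
    linarith
  have hsum2 : -(d * 4) ≤ ∑ p ∈ S, ∑ q ∈ S.erase p, rootKernel P r p q := by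
    have h1 : ∀ p ∈ S, -(N * (d * (2 * e))) ≤ ∑ q ∈ S.erase p, rootKernel P r p q := fun p hp => by
      refine le_trans ?_ (Finset.sum_le_sum (hKpq p hp))
      rw [Finset.sum_const, nsmul_eq_mul]
      have : ((S.erase p).card : ℝ) ≤ N :=
        le_trans (by exact_mod_cast Finset.card_le_card (Finset.erase_subset p S)) hcard
      have h0 : 0 ≤ d * (2 * e) := by positivity
      have := mul_le_mul_of_nonneg_right this h0
      linarith
    refine le_trans ?_ (Finset.sum_le_sum h1)
    rw [Finset.sum_const, nsmul_eq_mul]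
    have h0 : 0 ≤ N * (d * (2 * e)) := by positivity
    have h2 := mul_le_mul_of_nonneg_right hcard h0
    have : (N : ℝ) * (N * (d * (2 * e))) = d * 4 := by
      calc (N : ℝ) * (N * (d * (2 * e))) = d * (2 * ((N : ℝ) ^ 2 * e)) := by ring
        _ = d * 4 := by rw [hNNe]; ring
    linarith
  -- The discriminant argument is not available here, because p-th powers of distinct roots may
  -- coincide. Averaging over primes reduces these terms to the energy of the roots themselves.
  have hdiag : -(d * (2 * N * (1 + L) * (L + 4))) ≤ ∑ p ∈ S, rootKernel P r p p := by
    refine le_trans ?_ (sum_prime_rootKernel_ge P hSp hSN hρ0 hρ1 (by omega))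
    rw [hlogρ]
    have h0 : 0 ≤ N * (2 * (1 - -L)) := by
      have : 0 ≤ 1 - -L := by linarith
      positivity
    have h1 : -(d * (L + 4)) ≤ rootKernel P ρ 1 1 := by
      refine le_trans (neg_le_neg (mul_le_mul_of_nonneg_left ?_ (by linarith))) hK11'
      linarith
    have := mul_le_mul_of_nonneg_left h1 h0
    linarith
  have hK11T : -(d * (T ^ 2 * (L + 4))) ≤ T ^ 2 * rootKernel P r 1 1 := by
    have h1 : -(d * (L + 4)) ≤ rootKernel P r 1 1 := by
      refine le_trans (neg_le_neg (mul_le_mul_of_nonneg_left ?_ (by linarith))) hK11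
      linarith
    have := mul_le_mul_of_nonneg_left h1 (sq_nonneg T)
    linarith
  have hsum1T := mul_le_mul_of_nonneg_left hsum1 (by linarith : 0 ≤ 2 * T)
  have hfin : d * (2 * T * Chebyshev.theta N) ≤ d * (T ^ 2 * (L + 4) + 8 * T + 4 +
      2 * N * (1 + L) * (L + 4)) := by linarith
  exact le_of_mul_le_mul_left hfin (by linarith)

theorem eventually_half_le_theta :
    ∀ᶠ n : ℕ in Filter.atTop, (n : ℝ) / 2 ≤ Chebyshev.theta n := by
  have h1 : ∀ᶠ x : ℝ in Filter.atTop, ‖Real.log x‖ ≤ (1 / 100) * ‖x ^ (1 / 2 : ℝ)‖ :=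
    (isLittleO_log_rpow_atTop (by norm_num : (0 : ℝ) < 1 / 2)).bound (by norm_num)
  have h2 := tendsto_natCast_atTop_atTop (R := ℝ) |>.eventually h1
  filter_upwards [h2, Filter.eventually_ge_atTop 10000] with n hn hn1
  have hn1' : (10000 : ℝ) ≤ n := by exact_mod_cast hn1
  have hs : (n : ℝ) ^ (1 / 2 : ℝ) = √n := (Real.sqrt_eq_rpow _).symm
  rw [hs, Real.norm_of_nonneg (Real.log_nonneg (by linarith)),
    Real.norm_of_nonneg (Real.sqrt_nonneg _)] at hn
  have hsq := Real.mul_self_sqrt (by linarith : (0 : ℝ) ≤ n)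
  have hs0 := Real.sqrt_nonneg (n : ℝ)
  have hge := Chebyshev.theta_ge n
  have hlog1 : Real.log (n + 1) ≤ Real.log n + 1 := by
    have : Real.log (n + 1) ≤ Real.log (n * 2) := Real.log_le_log (by linarith) (by linarith)
    rw [Real.log_mul (by linarith) (by norm_num)] at this
    linarith [Real.log_two_lt_d9]
  have hlog2 := Real.log_two_gt_d9
  have hs100 : 100 ≤ √(n : ℝ) := Real.le_sqrt_of_sq_le (by linarith)
  nlinarith

/-- A weak form of Dobrowolski's theorem. -/
theorem rpow_neg_le_log_mahlerMeasure {η : ℝ} (hη : 0 < η) (hη1 : η ≤ 1) :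
    ∀ᶠ n : ℕ in Filter.atTop, ∀ P : ℤ[X], P.Monic → Irreducible P →
      1 < (P.map (Int.castRingHom ℂ)).mahlerMeasure → P.natDegree = n →
      (n : ℝ) ^ (-η) ≤ Real.log (P.map (Int.castRingHom ℂ)).mahlerMeasure := by
  have hcast := tendsto_natCast_atTop_atTop (R := ℝ)
  have h1 : ∀ᶠ x : ℝ in Filter.atTop, ‖Real.log x‖ ≤ (1 / 6) * ‖x ^ (η / 16)‖ :=
    (isLittleO_log_rpow_atTop (by positivity : 0 < η / 16)).bound (by norm_num)
  have h2 : Filter.Tendsto (fun x : ℝ => x ^ (η / 16)) Filter.atTop Filter.atTop :=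
    tendsto_rpow_atTop (by positivity)
  have h3 : Filter.Tendsto (fun n : ℕ => ⌊(n : ℝ) ^ (η / 4)⌋₊) Filter.atTop Filter.atTop :=
    tendsto_nat_floor_atTop.comp ((tendsto_rpow_atTop (by positivity : 0 < η / 4)).comp hcast)
  filter_upwards [hcast.eventually h1, hcast.eventually (h2.eventually_ge_atTop 100),
    h3.eventually eventually_half_le_theta, h3.eventually_ge_atTop 1,
    Filter.eventually_ge_atTop 1] with n hlog hbig hθ hN1 hn1 P hP hirr hM hdeg
  by_contra hlt
  rw [not_le] at hlt
  -- Small enough that N³ ≤ n^η, so the assumed failure gives log M(P) ≤ 1/N³, yet larger than any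
  -- power of log n.
  set N := ⌊(n : ℝ) ^ (η / 4)⌋₊ with hN
  have hn1' : (1 : ℝ) ≤ n := by exact_mod_cast hn1
  have hn0 : (0 : ℝ) ≤ n := by linarith
  have hN1' : (1 : ℝ) ≤ N := by exact_mod_cast hN1
  have hNle : (N : ℝ) ≤ (n : ℝ) ^ (η / 4) := Nat.floor_le (by positivity)
  have hNge : (n : ℝ) ^ (η / 4) < N + 1 := Nat.lt_floor_add_one _
  have hN3 : (N : ℝ) ^ 3 ≤ (n : ℝ) ^ η := by
    calc (N : ℝ) ^ 3 ≤ ((n : ℝ) ^ (η / 4)) ^ 3 := by gcongr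
      _ = (n : ℝ) ^ (η / 4 * 3) := by rw [← Real.rpow_natCast, ← Real.rpow_mul hn0]; norm_num
      _ ≤ (n : ℝ) ^ η := Real.rpow_le_rpow_of_exponent_le hn1' (by linarith)
  have hN3' : (N : ℝ) ^ 3 ≤ n := hN3.trans (by
    simpa using Real.rpow_le_rpow_of_exponent_le hn1' hη1)
  have hℓ : Real.log (P.map (Int.castRingHom ℂ)).mahlerMeasure ≤ 1 / (N : ℝ) ^ 3 := by
    refine hlt.le.trans ?_
    rw [Real.rpow_neg hn0, ← one_div]
    exact one_div_le_one_div_of_le (by positivity) hN3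
  -- With T = √N the left side has order at least N^(3/2) and the right side at most N·L². This
  -- forces √N ≤ 2(L + 4)², which fails for large n.
  have key := two_mul_theta_le hP hirr hM hN1 (by omega) hℓ (Real.sqrt_nonneg (N : ℝ))
  rw [hdeg] at key
  set L := Real.log (n * (N : ℝ) ^ 3) with hL
  have hL0 : 0 ≤ L := Real.log_nonneg (one_le_mul_of_one_le_of_one_le hn1' (one_le_pow₀ hN1'))
  have hlog0 : 0 ≤ Real.log n := Real.log_nonneg hn1'
  have hL2 : L ≤ 2 * Real.log n := by
    rw [hL, Real.log_mul (by positivity) (by positivity)]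
    have := Real.log_le_log (by positivity) hN3'
    linarith
  rw [Real.norm_of_nonneg hlog0, Real.norm_of_nonneg (by positivity)] at hlog
  set y := (n : ℝ) ^ (η / 16) with hy
  have hy4 : (n : ℝ) ^ (η / 4) = y ^ 4 := by
    rw [hy, ← Real.rpow_natCast, ← Real.rpow_mul hn0]; congr 1; push_cast; ring
  set s := √(N : ℝ) with hs
  have hs2 : s ^ 2 = N := Real.sq_sqrt (by linarith)
  have hs1 : 1 ≤ s := Real.one_le_sqrt.2 hN1'
  rw [hy4] at hNge
  have hsy : 7 / 10 * y ^ 2 ≤ s := by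
    refine (sq_le_sq₀ (by positivity) (by positivity)).1 ?_
    rw [hs2]
    nlinarith
  have hkey2 : s * N ≤ N * (2 * (L + 4) ^ 2) := by
    have h4 : s ≤ N := by nlinarith
    have : s * N ≤ 2 * s * Chebyshev.theta N := by nlinarith
    rw [hs2] at key
    nlinarith
  have hkey3 : s ≤ 2 * (L + 4) ^ 2 := by
    rw [mul_comm] at hkey2
    exact le_of_mul_le_mul_left hkey2 (by linarith)
  have hL4 : L + 4 ≤ (1 / 3 + 4 / 100) * y := by linarith
  have : (L + 4) ^ 2 ≤ ((1 / 3 + 4 / 100) * y) ^ 2 := by gcongr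
  nlinarith

end

/-! ### Products of `1 - y ^ n` with sine weights -/

theorem sum_range_sum_range_eq (f : ℕ → ℕ → ℝ) (J : ℕ) :
    ∑ i ∈ Finset.range J, ∑ j ∈ Finset.range J, f i j
      = ∑ i ∈ Finset.range J, f i i +
        ∑ j ∈ Finset.range J, ∑ i ∈ Finset.range j, (f i j + f j i) := by
  induction J with
  | zero => simp
  | succ J ih =>
    rw [Finset.sum_range_succ, Finset.sum_range_succ (fun i => f i i), Finset.sum_range_succ
      (fun j => ∑ i ∈ Finset.range j, (f i j + f j i)), Finset.sum_range_succ (f J),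
      Finset.sum_congr rfl (fun i _ => Finset.sum_range_succ (f i) J), Finset.sum_add_distrib, ih,
      Finset.sum_add_distrib]
    ring

/-- Energy of the points z^i: on the circle z^j times the conjugate of z^i is z^(j-i), and the
diagonal contributes log(1 - r). -/
theorem two_mul_sum_log_norm_sphere (t : ℕ → ℝ) (J : ℕ) {r : ℝ} (hr0 : 0 ≤ r) (hr1 : r < 1)
    {z : ℂ} (hz : ‖z‖ = 1) :
    2 * ∑ j ∈ Finset.range J, ∑ i ∈ Finset.range j, t i * t j * Real.log ‖1 - r * z ^ (j - i)‖
      ≤ -(∑ i ∈ Finset.range J, t i ^ 2) * Real.log (1 - r) := by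
  have h := energy_nonneg (Finset.range J) t (fun i => z ^ i)
    (fun i _ => by rw [norm_pow, hz, one_pow]) hr0 hr1
  rw [sum_range_sum_range_eq] at h
  have hzz : ∀ n : ℕ, z ^ n * (starRingEnd ℂ) (z ^ n) = 1 := fun n => by
    rw [Complex.mul_conj, Complex.normSq_eq_norm_sq, norm_pow, hz]; simp
  have e1 : ∑ i ∈ Finset.range J, t i * t i *
      Real.log ‖1 - r * (z ^ i * (starRingEnd ℂ) (z ^ i))‖
      = (∑ i ∈ Finset.range J, t i ^ 2) * Real.log (1 - r) := by
    rw [Finset.sum_mul]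
    refine Finset.sum_congr rfl fun i _ => ?_
    rw [hzz, mul_one, ← Complex.ofReal_one, ← Complex.ofReal_sub, Complex.norm_real,
      Real.norm_of_nonneg (by linarith)]
    ring
  have e2 : ∀ j, ∀ i ∈ Finset.range j,
      t i * t j * Real.log ‖1 - r * (z ^ i * (starRingEnd ℂ) (z ^ j))‖ +
      t j * t i * Real.log ‖1 - r * (z ^ j * (starRingEnd ℂ) (z ^ i))‖
      = 2 * (t i * t j * Real.log ‖1 - r * z ^ (j - i)‖) := by
    intro j i hi
    have hij : i + (j - i) = j := Nat.add_sub_cancel' (Finset.mem_range.1 hi).le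
    have a1 : z ^ j * (starRingEnd ℂ) (z ^ i) = z ^ (j - i) := by
      conv_lhs => rw [← hij, pow_add]
      rw [mul_right_comm, hzz, one_mul]
    have a2 : ‖1 - r * (z ^ i * (starRingEnd ℂ) (z ^ j))‖ = ‖1 - r * z ^ (j - i)‖ := by
      rw [← RCLike.norm_conj, ← a1]
      congr 1
      simp only [map_sub, map_mul, map_one, Complex.conj_ofReal, Complex.conj_conj]
      ring
    rw [a1, a2]
    ring
  rw [e1, Finset.sum_congr rfl fun j _ => Finset.sum_congr rfl (e2 j)] at h
  simp only [← Finset.mul_sum] at h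
  linarith

/-- Inside the disc the energy no longer involves powers of z alone. However, the left side is twice
the logarithm of the modulus of a holomorphic function, so the maximum principle extends the bound
from the circle. -/
theorem two_mul_sum_log_norm_disc (t : ℕ → ℝ) (J : ℕ) {r : ℝ} (hr0 : 0 ≤ r) (hr1 : r < 1)
    {z : ℂ} (hz : ‖z‖ ≤ 1) :
    2 * ∑ j ∈ Finset.range J, ∑ i ∈ Finset.range j, t i * t j * Real.log ‖1 - r * z ^ (j - i)‖
      ≤ -(∑ i ∈ Finset.range J, t i ^ 2) * Real.log (1 - r) := by
  set G : ℂ → ℂ := fun w => Complex.exp (∑ j ∈ Finset.range J, ∑ i ∈ Finset.range j,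
    ((t i * t j : ℝ) : ℂ) * Complex.log (1 - r * w ^ (j - i))) with hG
  have hslit : ∀ w : ℂ, ‖w‖ ≤ 1 → ∀ n : ℕ, 1 - (r : ℂ) * w ^ n ∈ Complex.slitPlane := by
    intro w hw n
    rw [sub_eq_add_neg]
    refine Complex.mem_slitPlane_of_norm_lt_one ?_
    rw [norm_neg, norm_mul, norm_pow, Complex.norm_real, Real.norm_of_nonneg hr0]
    have : ‖w‖ ^ n ≤ 1 := pow_le_one₀ (norm_nonneg _) hw
    nlinarith
  have hnorm : ∀ w : ℂ, ‖w‖ ≤ 1 → ‖G w‖ = Real.exp (∑ j ∈ Finset.range J, ∑ i ∈ Finset.range j,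
      t i * t j * Real.log ‖1 - r * w ^ (j - i)‖) := by
    intro w _
    rw [hG]
    simp only [Complex.norm_exp, Complex.re_sum, Complex.re_ofReal_mul, Complex.log_re]
  have hdiff : DiffContOnCl ℂ G (Metric.ball 0 1) := by
    refine DifferentiableOn.diffContOnCl ?_
    rw [closure_ball _ one_ne_zero]
    intro w hw
    have hw' : ‖w‖ ≤ 1 := by simpa using hw
    refine DifferentiableAt.differentiableWithinAt ?_
    refine DifferentiableAt.cexp ?_
    refine DifferentiableAt.fun_sum fun j _ => DifferentiableAt.fun_sum fun i _ => ?_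
    exact ((by fun_prop : DifferentiableAt ℂ (fun w : ℂ => 1 - (r : ℂ) * w ^ (j - i)) w).clog
      (hslit w hw' _)).const_mul _
  have hmax := Complex.norm_le_of_forall_mem_frontier_norm_le Metric.isBounded_ball hdiff
    (C := Real.exp (-(∑ i ∈ Finset.range J, t i ^ 2) * Real.log (1 - r) / 2))
    (fun w hw => by
      rw [frontier_ball _ one_ne_zero] at hw
      have hw' : ‖w‖ = 1 := by simpa using hw
      rw [hnorm w hw'.le, Real.exp_le_exp]
      linarith [two_mul_sum_log_norm_sphere t J hr0 hr1 hw'])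
    (z := z) (by rw [closure_ball _ one_ne_zero]; simpa using hz)
  rw [hnorm z hz, Real.exp_le_exp] at hmax
  linarith

theorem log_norm_one_sub_pow_of_one_lt {y : ℂ} (hy : 1 < ‖y‖) {n : ℕ} (hn : y ^ n ≠ 1) :
    Real.log ‖1 - y ^ n‖ = Real.log ‖1 - y⁻¹ ^ n‖ + n * Real.posLog ‖y‖ := by
  have hy0 : y ≠ 0 := by rintro rfl; simp at hy; linarith
  have h1 : ‖1 - y ^ n‖ = ‖1 - y⁻¹ ^ n‖ * ‖y‖ ^ n := by
    rw [← norm_pow, ← norm_mul, sub_mul, one_mul, ← mul_pow, inv_mul_cancel₀ hy0, one_pow,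
      norm_sub_rev]
  have h2 : ‖1 - y⁻¹ ^ n‖ ≠ 0 := fun h => by
    rw [h, zero_mul, norm_eq_zero, sub_eq_zero] at h1
    exact hn h1.symm
  rw [h1, Real.log_mul h2 (by positivity), Real.log_pow,
    Real.posLog_eq_log (by rw [abs_of_nonneg (norm_nonneg _)]; exact hy.le)]

/-- Nonnegative weights allow the regularisation to be removed term by term. Outside the disc, |1 -
y^n| = |y|^n |1 - y^(-n)| reduces to 1/y and produces the log⁺ term. -/
theorem sum_log_norm_one_sub_pow_le {t : ℕ → ℝ} {J : ℕ} (ht : ∀ i < J, 0 ≤ t i) {r : ℝ}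
    (hr0 : 0 ≤ r) (hr1 : r < 1) {y : ℂ} (hy : ∀ n, 0 < n → y ^ n ≠ 1) :
    ∑ j ∈ Finset.range J, ∑ i ∈ Finset.range j, t i * t j * Real.log ‖1 - y ^ (j - i)‖
      ≤ -(∑ i ∈ Finset.range J, t i ^ 2) * Real.log (1 - r) / 2
        + (∑ j ∈ Finset.range J, ∑ i ∈ Finset.range j, t i * t j) * (1 - r)
        + (∑ j ∈ Finset.range J, ∑ i ∈ Finset.range j, t i * t j * ((j - i : ℕ) : ℝ)) *
          Real.posLog ‖y‖ := by
  have disc : ∀ w : ℂ, ‖w‖ ≤ 1 → (∀ n, 0 < n → w ^ n ≠ 1) →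
      ∑ j ∈ Finset.range J, ∑ i ∈ Finset.range j, t i * t j * Real.log ‖1 - w ^ (j - i)‖
      ≤ -(∑ i ∈ Finset.range J, t i ^ 2) * Real.log (1 - r) / 2
        + (∑ j ∈ Finset.range J, ∑ i ∈ Finset.range j, t i * t j) * (1 - r) := by
    intro w hw hw1
    have h1 := two_mul_sum_log_norm_disc t J hr0 hr1 hw
    have h2 : ∑ j ∈ Finset.range J, ∑ i ∈ Finset.range j, t i * t j * Real.log ‖1 - w ^ (j - i)‖
        ≤ ∑ j ∈ Finset.range J, ∑ i ∈ Finset.range j,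
          (t i * t j * Real.log ‖1 - r * w ^ (j - i)‖ + t i * t j * (1 - r)) := by
      refine Finset.sum_le_sum fun j hj => Finset.sum_le_sum fun i hi => ?_
      rw [Finset.mem_range] at hi hj
      rw [← mul_add]
      refine mul_le_mul_of_nonneg_left ?_ (mul_nonneg (ht i (hi.trans hj)) (ht j hj))
      exact log_norm_one_sub_le (by rw [norm_pow]; exact pow_le_one₀ (norm_nonneg _) hw)
        (hw1 _ (by omega)) hr0 hr1.le
    simp only [Finset.sum_add_distrib, ← Finset.sum_mul] at h2 ⊢
    linarith
  rcases le_or_gt ‖y‖ 1 with h | h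
  · rw [(Real.posLog_eq_zero_iff ‖y‖).2 (by rw [abs_of_nonneg (norm_nonneg _)]; exact h), mul_zero,
      add_zero]
    exact disc y h hy
  · have h1 := disc y⁻¹ (by rw [norm_inv]; exact inv_le_one_of_one_le₀ h.le)
      (fun n hn => by rw [inv_pow]; exact fun e => hy n hn (inv_eq_one.1 e))
    have h2 : ∑ j ∈ Finset.range J, ∑ i ∈ Finset.range j, t i * t j * Real.log ‖1 - y ^ (j - i)‖
        = ∑ j ∈ Finset.range J, ∑ i ∈ Finset.range j,
          (t i * t j * Real.log ‖1 - y⁻¹ ^ (j - i)‖ + t i * t j * ((j - i : ℕ) : ℝ) *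
            Real.posLog ‖y‖) := by
      refine Finset.sum_congr rfl fun j _ => Finset.sum_congr rfl fun i hi => ?_
      rw [Finset.mem_range] at hi
      rw [log_norm_one_sub_pow_of_one_lt h (hy _ (by omega))]
      ring
    rw [h2]
    simp only [Finset.sum_add_distrib, ← Finset.sum_mul] at h1 ⊢
    linarith

/-! ### Closed forms for sums of the sine weights -/

theorem sum_range_sin (θ : ℝ) (K : ℕ) :
    2 * (1 - Real.cos θ) * ∑ i ∈ Finset.range (K + 1), Real.sin (i * θ)
      = Real.sin θ - Real.sin ((K + 1) * θ) + Real.sin (K * θ) := by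
  induction K with
  | zero => simp
  | succ K ih =>
    rw [Finset.sum_range_succ, mul_add, ih]
    push_cast
    rw [show ((K : ℝ) + 1 + 1) * θ = (K + 1) * θ + θ by ring, Real.sin_add _ θ,
      show (K : ℝ) * θ = (K + 1) * θ - θ by ring, Real.sin_sub]
    ring

theorem sum_range_mul_sin (θ : ℝ) (K : ℕ) :
    2 * (1 - Real.cos θ) * ∑ i ∈ Finset.range K, ((K : ℝ) - i) * Real.sin (i * θ)
      = K * Real.sin θ - Real.sin (K * θ) := by
  induction K with
  | zero => simp
  | succ K ih =>
    have h : ∑ i ∈ Finset.range (K + 1), (((K + 1 : ℕ) : ℝ) - i) * Real.sin (i * θ)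
        = ∑ i ∈ Finset.range K, ((K : ℝ) - i) * Real.sin (i * θ)
          + ∑ i ∈ Finset.range (K + 1), Real.sin (i * θ) := by
      rw [Finset.sum_range_succ, Finset.sum_range_succ, ← add_assoc, ← Finset.sum_add_distrib]
      push_cast
      congr 1
      · exact Finset.sum_congr rfl fun i _ => by ring
      · ring
    rw [h, mul_add, ih, sum_range_sin]
    push_cast
    ring

theorem sum_range_sin_sq (θ : ℝ) (K : ℕ) :
    4 * Real.sin θ * ∑ i ∈ Finset.range K, Real.sin (i * θ) ^ 2
      = 2 * K * Real.sin θ - Real.sin ((2 * K - 1) * θ) - Real.sin θ := by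
  induction K with
  | zero => simp
  | succ K ih =>
    rw [Finset.sum_range_succ, mul_add, ih]
    push_cast
    rw [show (2 * ((K : ℝ) + 1) - 1) * θ = 2 * (K * θ) + θ by ring,
      show (2 * (K : ℝ) - 1) * θ = 2 * (K * θ) - θ by ring, Real.sin_add, Real.sin_sub,
      Real.cos_two_mul, Real.cos_sq']
    ring

section

variable {J : ℕ} (hJ : 2 ≤ J)

include hJ

theorem sum_range_sin_pi_div_sq :
    ∑ i ∈ Finset.range J, Real.sin (i * (Real.pi / J)) ^ 2 = J / 2 := by
  have hJ' : (2 : ℝ) ≤ J := by exact_mod_cast hJ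
  have hs : 0 < Real.sin (Real.pi / J) := Real.sin_pos_of_pos_of_lt_pi (by positivity)
    (by rw [div_lt_iff₀ (by linarith)]; nlinarith [Real.pi_pos])
  have h := sum_range_sin_sq (Real.pi / J) J
  have e : (2 * (J : ℝ) - 1) * (Real.pi / J) = 2 * Real.pi - Real.pi / J := by field_simp
  rw [e, Real.sin_two_pi_sub] at h
  have h2 : 4 * Real.sin (Real.pi / J) *
      (∑ i ∈ Finset.range J, Real.sin (i * (Real.pi / J)) ^ 2 - J / 2) = 0 := by linarith
  rcases mul_eq_zero.1 h2 with h3 | h3 <;> linarith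

theorem sum_range_sin_pi_div :
    (1 - Real.cos (Real.pi / J)) * ∑ i ∈ Finset.range J, Real.sin (i * (Real.pi / J))
      = Real.sin (Real.pi / J) := by
  have hJ' : (2 : ℝ) ≤ J := by exact_mod_cast hJ
  obtain ⟨K, rfl⟩ : ∃ K, J = K + 1 := ⟨J - 1, by omega⟩
  have h := sum_range_sin (Real.pi / (K + 1 : ℕ)) K
  have e1 : ((K : ℝ) + 1) * (Real.pi / (K + 1 : ℕ)) = Real.pi := by push_cast; field_simp
  have e2 : (K : ℝ) * (Real.pi / (K + 1 : ℕ)) = Real.pi - Real.pi / (K + 1 : ℕ) := by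
    push_cast; field_simp; ring
  rw [e1, e2, Real.sin_pi, Real.sin_pi_sub] at h
  linarith

theorem sum_sum_sin_mul_sin_mul_sub :
    4 * (1 - Real.cos (Real.pi / J)) * ∑ j ∈ Finset.range J, ∑ i ∈ Finset.range j,
      Real.sin (i * (Real.pi / J)) * Real.sin (j * (Real.pi / J)) * ((j - i : ℕ) : ℝ)
      = J * Real.cos (Real.pi / J) := by
  have hJ' : (2 : ℝ) ≤ J := by exact_mod_cast hJ
  set θ := Real.pi / J with hθ
  have hs : 0 < Real.sin θ := Real.sin_pos_of_pos_of_lt_pi (by positivity)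
    (by rw [hθ, div_lt_iff₀ (by linarith)]; nlinarith [Real.pi_pos])
  have hJθ : (J : ℝ) * θ = Real.pi := by rw [hθ]; field_simp
  have hA := sum_range_sin_pi_div hJ
  have hB := sum_range_sin_pi_div_sq hJ
  rw [← hθ] at hA hB
  have hG := sum_range_mul_sin θ J
  rw [hJθ, Real.sin_pi, sub_zero] at hG
  have hc : 0 < 1 - Real.cos θ := by
    nlinarith [Real.sin_sq_add_cos_sq θ, Real.cos_le_one θ]
  have hD : 2 * (1 - Real.cos θ) * ∑ j ∈ Finset.range J, (j : ℝ) * Real.sin (j * θ)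
      = J * Real.sin θ := by
    have : ∑ i ∈ Finset.range J, ((J : ℝ) - i) * Real.sin (i * θ)
        = J * ∑ i ∈ Finset.range J, Real.sin (i * θ)
          - ∑ i ∈ Finset.range J, (i : ℝ) * Real.sin (i * θ) := by
      rw [Finset.mul_sum, ← Finset.sum_sub_distrib]
      exact Finset.sum_congr rfl fun i _ => by ring
    rw [this] at hG
    linear_combination 2 * J * hA - hG
  have hN : 2 * (1 - Real.cos θ) * ∑ j ∈ Finset.range J, ∑ i ∈ Finset.range j,
      Real.sin (i * θ) * Real.sin (j * θ) * ((j - i : ℕ) : ℝ)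
      = Real.sin θ * ∑ j ∈ Finset.range J, (j : ℝ) * Real.sin (j * θ) - J / 2 := by
    rw [← hB, Finset.mul_sum, Finset.mul_sum, ← Finset.sum_sub_distrib]
    refine Finset.sum_congr rfl fun j _ => ?_
    have h1 := sum_range_mul_sin θ j
    have h2 : ∑ i ∈ Finset.range j, Real.sin (i * θ) * Real.sin (j * θ) * ((j - i : ℕ) : ℝ)
        = Real.sin (j * θ) * ∑ i ∈ Finset.range j, ((j : ℝ) - i) * Real.sin (i * θ) := by
      rw [Finset.mul_sum]
      refine Finset.sum_congr rfl fun i hi => ?_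
      rw [Nat.cast_sub (Finset.mem_range.1 hi).le]
      ring
    rw [h2]
    linear_combination Real.sin (j * θ) * h1
  -- The identity is proved times 1 - cos θ, so that the telescoped sums combine through sin² + cos²
  -- = 1 without division.
  have hfin : (1 - Real.cos θ) * (4 * (1 - Real.cos θ) * ∑ j ∈ Finset.range J,
      ∑ i ∈ Finset.range j, Real.sin (i * θ) * Real.sin (j * θ) * ((j - i : ℕ) : ℝ)
      - J * Real.cos θ) = 0 := by
    linear_combination 2 * (1 - Real.cos θ) * hN + Real.sin θ * hD +
      J * Real.sin_sq_add_cos_sq θ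
  rcases mul_eq_zero.1 hfin with h | h <;> linarith

theorem sum_sum_sin_mul_sin :
    2 * ∑ j ∈ Finset.range J, ∑ i ∈ Finset.range j,
      Real.sin (i * (Real.pi / J)) * Real.sin (j * (Real.pi / J))
      = (∑ i ∈ Finset.range J, Real.sin (i * (Real.pi / J))) ^ 2 - J / 2 := by
  have h := sum_range_sum_range_eq
    (fun i j => Real.sin (i * (Real.pi / J)) * Real.sin (j * (Real.pi / J))) J
  rw [← Finset.sum_mul_sum] at h
  simp only [← sq, sum_range_sin_pi_div_sq hJ] at h
  rw [h, Finset.mul_sum, add_sub_cancel_left]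
  refine Finset.sum_congr rfl fun j _ => ?_
  rw [Finset.mul_sum]
  exact Finset.sum_congr rfl fun i _ => by ring

end

set_option maxHeartbeats 1000000 in
/-- A probability weight on the exponents `0 < n < J` for which the weighted geometric mean of
`|1 - y ^ n|` is small uniformly in `y`. -/
theorem exists_weights {J : ℕ} (hJ : 4 ≤ J) :
    ∃ (I : Finset (Σ _ : ℕ, ℕ)) (w : (Σ _ : ℕ, ℕ) → ℝ) (n : (Σ _ : ℕ, ℕ) → ℕ) (N : ℝ),
      (∀ x ∈ I, 0 ≤ w x ∧ 0 < n x ∧ n x < J) ∧ ∑ x ∈ I, w x = 1 ∧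
      ∑ x ∈ I, w x * n x = N ∧ 0 ≤ N ∧ N ≤ J / (4 - Real.pi ^ 2 / J) ∧
      ∀ y : ℂ, (∀ k, 0 < k → y ^ k ≠ 1) →
        ∑ x ∈ I, w x * Real.log ‖1 - y ^ n x‖ ≤
          Real.pi ^ 2 * Real.log J / (2 * J * (4 - Real.pi ^ 2 / J)) + 1 / J
            + N * Real.posLog ‖y‖ := by
  have hJ4 : (4 : ℝ) ≤ J := by exact_mod_cast hJ
  set θ := Real.pi / J with hθ
  set t : ℕ → ℝ := fun i => Real.sin (i * θ) with ht
  set S := ∑ j ∈ Finset.range J, ∑ i ∈ Finset.range j, t i * t j with hS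
  set N₀ := ∑ j ∈ Finset.range J, ∑ i ∈ Finset.range j, t i * t j * ((j - i : ℕ) : ℝ) with hN₀
  have hB : ∑ i ∈ Finset.range J, t i ^ 2 = J / 2 := sum_range_sin_pi_div_sq (by omega)
  have hA := sum_range_sin_pi_div (J := J) (by omega)
  have hN := sum_sum_sin_mul_sin_mul_sub (J := J) (by omega)
  have hSA := sum_sum_sin_mul_sin (J := J) (by omega)
  rw [← hθ] at hA hN hSA
  set A := ∑ i ∈ Finset.range J, Real.sin (i * θ) with hAdef
  change 2 * S = A ^ 2 - J / 2 at hSA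
  change 4 * (1 - Real.cos θ) * N₀ = J * Real.cos θ at hN
  have hθ0 : 0 < θ := by positivity
  have hθJ : θ * J = Real.pi := by rw [hθ]; field_simp
  have hs : 0 < Real.sin θ := Real.sin_pos_of_pos_of_lt_pi hθ0
    (by rw [hθ, div_lt_iff₀ (by linarith)]; nlinarith [Real.pi_pos])
  -- All normalisations are measured in c ≤ π²/J²: the closed forms give cA² = 4 - c and 2cS = 4 - c
  -- - cJ/2, whence the lower bound q = 4 - π²/J for 2cS. It exceeds 1 because J ≥ 4.
  set c := 2 * (1 - Real.cos θ) with hc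
  have hc0 : 0 < c := by
    nlinarith [Real.sin_sq_add_cos_sq θ, Real.cos_le_one θ]
  have hcθ : c ≤ Real.pi ^ 2 / J ^ 2 := by
    have := Real.one_sub_sq_div_two_le_cos (x := θ)
    have e : Real.pi ^ 2 / (J : ℝ) ^ 2 = θ ^ 2 := by rw [hθ, div_pow]
    rw [e]; linarith
  have hcA : c * A ^ 2 = 4 - c := by
    have h1 : (1 - Real.cos θ) ^ 2 * A ^ 2 = (1 - Real.cos θ) * (1 + Real.cos θ) := by
      rw [← mul_pow, hA]; linear_combination Real.sin_sq_add_cos_sq θ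
    have h2 : (1 - Real.cos θ) * ((1 - Real.cos θ) * A ^ 2 - (1 + Real.cos θ)) = 0 := by
      linear_combination h1
    rcases mul_eq_zero.1 h2 with h3 | h3
    · linarith
    · rw [hc]; linear_combination 2 * h3
  have hcJ : c * J ≤ Real.pi ^ 2 / J := by
    calc c * J ≤ Real.pi ^ 2 / J ^ 2 * J := by gcongr
      _ = Real.pi ^ 2 / J := by field_simp
  have hpi : Real.pi ^ 2 < 10 := by nlinarith [Real.pi_lt_d2, Real.pi_gt_three]
  have hpiJ : Real.pi ^ 2 / J < 3 := by rw [div_lt_iff₀ (by linarith)]; linarith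
  set q := 4 - Real.pi ^ 2 / J with hq
  have hq0 : 0 < q := by linarith
  have h2cS : q ≤ 2 * c * S := by
    have : 2 * c * S = 4 - c - c * J / 2 := by linear_combination c * hSA + hcA
    rw [this, hq]
    nlinarith
  have hS0 : 0 < S := by
    by_contra h
    have : c * S ≤ 0 := mul_nonpos_of_nonneg_of_nonpos hc0.le (not_lt.1 h)
    linarith
  have ht0 : ∀ i < J, 0 ≤ t i := fun i hi => by
    refine Real.sin_nonneg_of_nonneg_of_le_pi (by positivity) ?_
    have : (i : ℝ) ≤ J := by exact_mod_cast hi.le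
    nlinarith
  have hN₀0 : 0 ≤ N₀ := by
    refine Finset.sum_nonneg fun j hj => Finset.sum_nonneg fun i hi => ?_
    rw [Finset.mem_range] at hi hj
    exact mul_nonneg (mul_nonneg (ht0 i (hi.trans hj)) (ht0 j hj)) (Nat.cast_nonneg _)
  refine ⟨(Finset.range J).sigma (fun j => Finset.range j), fun x => t x.2 * t x.1 / S,
    fun x => x.1 - x.2, N₀ / S, ?_, ?_, ?_, div_nonneg hN₀0 hS0.le, ?_, ?_⟩
  · intro x hx
    rw [Finset.mem_sigma, Finset.mem_range, Finset.mem_range] at hx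
    refine ⟨div_nonneg (mul_nonneg (ht0 _ (hx.2.trans hx.1)) (ht0 _ hx.1)) hS0.le, ?_, ?_⟩
    · exact Nat.sub_pos_of_lt hx.2
    · exact lt_of_le_of_lt (Nat.sub_le _ _) hx.1
  · rw [← Finset.sum_div, Finset.sum_sigma]
    exact div_self hS0.ne'
  · simp only [div_mul_eq_mul_div]
    rw [← Finset.sum_div, Finset.sum_sigma]
  · rw [div_le_div_iff₀ hS0 hq0]
    have h1 : 2 * c * N₀ ≤ J := by
      have : 2 * c * N₀ = J * Real.cos θ := by rw [hc]; linear_combination hN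
      rw [this]
      nlinarith [Real.cos_le_one θ]
    nlinarith
  · intro y hy
    have hJi : (J : ℝ)⁻¹ < 1 := inv_lt_one_of_one_lt₀ (by linarith)
    have hJi0 : 0 < (J : ℝ)⁻¹ := by positivity
    -- The choice 1 - r = 1/J turns -log(1 - r) into log J and leaves only 1/J after normalisation.
    have h := sum_log_norm_one_sub_pow_le ht0 (r := 1 - (J : ℝ)⁻¹) (by linarith) (by linarith) hy
    rw [hB, sub_sub_cancel, Real.log_inv] at h
    simp only [div_mul_eq_mul_div]
    rw [← Finset.sum_div, Finset.sum_sigma, div_le_iff₀ hS0]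
    refine h.trans ?_
    have hlog : 0 ≤ Real.log J := Real.log_nonneg (by linarith)
    have e1 : -((J : ℝ) / 2) * -Real.log J / 2
        ≤ Real.pi ^ 2 * Real.log J / (2 * J * q) * S := by
      rw [div_mul_eq_mul_div, le_div_iff₀ (mul_pos (by linarith) hq0)]
      have h1 : c * (J : ℝ) ^ 2 ≤ Real.pi ^ 2 := by
        rwa [le_div_iff₀ (by positivity)] at hcθ
      have h2 : q * (J : ℝ) ^ 2 ≤ 2 * S * Real.pi ^ 2 :=
        calc q * (J : ℝ) ^ 2 ≤ 2 * c * S * (J : ℝ) ^ 2 :=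
              mul_le_mul_of_nonneg_right h2cS (sq_nonneg _)
          _ = 2 * S * (c * (J : ℝ) ^ 2) := by ring
          _ ≤ 2 * S * Real.pi ^ 2 := mul_le_mul_of_nonneg_left h1 (by linarith)
      have h3 := mul_le_mul_of_nonneg_right h2 hlog
      linarith
    have e2 : N₀ * Real.posLog ‖y‖ / S * S = N₀ * Real.posLog ‖y‖ :=
      div_mul_cancel₀ _ hS0.ne'
    rw [add_mul, add_mul, e2, one_div, mul_comm S]
    have e3 : N₀ = ∑ j ∈ Finset.range J, ∑ i ∈ Finset.range j, t i * t j * ((j - i : ℕ) : ℝ) := rfl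
    rw [← e3]
    linarith

/-! ### Roots close to a root of `x ^ m = ±1` -/

section

open Polynomial

theorem norm_pow_sub_pow_le {ω μ : ℂ} (hω : ‖ω‖ = 1) (k : ℕ) :
    ‖ω ^ k - μ ^ k‖ ≤ k * ‖ω - μ‖ * max 1 ‖μ‖ ^ k := by
  rw [← (Commute.all ω μ).geom_sum₂_mul k, norm_mul]
  have h : ‖∑ i ∈ Finset.range k, ω ^ i * μ ^ (k - 1 - i)‖ ≤ k * max 1 ‖μ‖ ^ k := by
    calc _ ≤ ∑ i ∈ Finset.range k, max 1 ‖μ‖ ^ k := by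
          refine norm_sum_le_of_le _ fun i _ => ?_
          rw [norm_mul, norm_pow, norm_pow, hω, one_pow, one_mul]
          calc ‖μ‖ ^ (k - 1 - i) ≤ max 1 ‖μ‖ ^ (k - 1 - i) :=
                pow_le_pow_left₀ (norm_nonneg _) (le_max_right _ _) _
            _ ≤ max 1 ‖μ‖ ^ k := pow_le_pow_right₀ (le_max_left _ _) (by omega)
      _ = _ := by simp
  calc _ ≤ k * max 1 ‖μ‖ ^ k * ‖ω - μ‖ := mul_le_mul_of_nonneg_right h (norm_nonneg _)
    _ = _ := by ring

/-- `β` behaves like a root at distance at most `δ` from a solution of `x ^ m = σ`. -/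
def CloseToSign (m : ℕ) (σ : ℤ) (δ : ℝ) (β : ℂ) : Prop :=
  ∀ n : ℕ, ‖1 - ((σ : ℂ) * β ^ m) ^ n‖ ≤ (m * n : ℕ) * δ * max 1 ‖β‖ ^ (m * n)

theorem closeToSign_self {m : ℕ} (hm : m ≠ 0) {σ : ℤ} (hσ : σ = 1 ∨ σ = -1) {ω : ℂ}
    (hω : ω ^ m = σ) (μ : ℂ) : CloseToSign m σ ‖ω - μ‖ μ := by
  have hσ2 : (σ : ℂ) * σ = 1 := by rcases hσ with rfl | rfl <;> simp
  have hσn : ‖(σ : ℂ)‖ = 1 := by rcases hσ with rfl | rfl <;> simp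
  have hω1 : ‖ω‖ = 1 := by
    refine (pow_eq_one_iff_of_nonneg (norm_nonneg _) hm).1 ?_
    rw [← norm_pow, hω, hσn]
  intro n
  have e : 1 - ((σ : ℂ) * μ ^ m) ^ n = (σ : ℂ) ^ n * (ω ^ (m * n) - μ ^ (m * n)) := by
    rw [pow_mul, pow_mul, hω, mul_sub, ← mul_pow, ← mul_pow, hσ2, one_pow]
  rw [e, norm_mul, norm_pow, hσn, one_pow, one_mul]
  exact norm_pow_sub_pow_le hω1 _

/-- Inversion divides |1 - (σβ^m)^n| by |β|^(mn), and max(1, |β|)^(mn) scales in the same way. So δ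
is preserved exactly, unlike the distance to ω itself. -/
theorem CloseToSign.inv {m : ℕ} {σ : ℤ} (hσ : σ = 1 ∨ σ = -1) {δ : ℝ} {β : ℂ} (hβ : β ≠ 0)
    (h : CloseToSign m σ δ β) : CloseToSign m σ δ β⁻¹ := by
  intro n
  have hσ2 : (σ : ℂ) * σ = 1 := by rcases hσ with rfl | rfl <;> simp
  have hσn : ‖(σ : ℂ)‖ = 1 := by rcases hσ with rfl | rfl <;> simp
  have hpos : 0 < ‖β‖ := norm_pos_iff.2 hβ
  have e : (1 - ((σ : ℂ) * β⁻¹ ^ m) ^ n) * ((σ : ℂ) * β ^ m) ^ n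
      = -(1 - ((σ : ℂ) * β ^ m) ^ n) := by
    rw [sub_mul, ← mul_pow]
    have : (σ : ℂ) * β⁻¹ ^ m * ((σ : ℂ) * β ^ m) = 1 := by
      calc _ = (σ : ℂ) * σ * (β⁻¹ * β) ^ m := by rw [mul_pow]; ring
        _ = 1 := by rw [hσ2, inv_mul_cancel₀ hβ]; simp
    rw [this]; ring
  have e2 : ‖1 - ((σ : ℂ) * β⁻¹ ^ m) ^ n‖ * ‖β‖ ^ (m * n) = ‖1 - ((σ : ℂ) * β ^ m) ^ n‖ := by
    rw [← norm_neg (1 - ((σ : ℂ) * β ^ m) ^ n), ← e, norm_mul, norm_pow ((σ : ℂ) * β ^ m),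
      norm_mul (σ : ℂ), hσn, one_mul, norm_pow, ← pow_mul]
  have e3 : max 1 ‖β⁻¹‖ * ‖β‖ = max 1 ‖β‖ := by
    rw [norm_inv, max_mul_of_nonneg _ _ hpos.le, one_mul, inv_mul_cancel₀ hpos.ne', max_comm]
  refine le_of_mul_le_mul_right ?_ (pow_pos hpos (m * n))
  rw [e2, mul_assoc, ← mul_pow, e3]
  exact h n

theorem CloseToSign.conj {m : ℕ} {σ : ℤ} {δ : ℝ} {β : ℂ} (h : CloseToSign m σ δ β) :
    CloseToSign m σ δ ((starRingEnd ℂ) β) := by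
  intro n
  have := h n
  rwa [← RCLike.norm_conj (1 - ((σ : ℂ) * β ^ m) ^ n), map_sub, map_one, map_pow, map_mul, map_pow,
    map_intCast, ← RCLike.norm_conj β] at this

/-- The averaged resultants of P with 1 - (σx^m)^n are nonnegative. Roots outside C are bounded by
the uniform estimate H, those in C by log δ + log(mJ); as H ≥ 0, it may be counted for every root.
-/
theorem card_mul_neg_log_le {P : ℤ[X]} (hP : P.Monic) (hirr : Irreducible P)
    (hM : 1 < (P.map (Int.castRingHom ℂ)).mahlerMeasure) {m : ℕ} (hm : 1 ≤ m) {σ : ℤ}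
    (hσ : σ = 1 ∨ σ = -1) {δ : ℝ} (hδ : 0 < δ) {C : Finset ℂ} (hC : C ⊆ complexRoots P)
    (hclose : ∀ β ∈ C, CloseToSign m σ δ β) {J : ℕ} (hJ : 4 ≤ J) :
    C.card * -Real.log δ ≤
      P.natDegree * (Real.pi ^ 2 * Real.log J / (2 * J * (4 - Real.pi ^ 2 / J)) + 1 / J) +
      m * J * Real.log (P.map (Int.castRingHom ℂ)).mahlerMeasure / (4 - Real.pi ^ 2 / J) +
      C.card * Real.log (m * J) := by
  obtain ⟨I, w, n, N, hI, hw1, hwN, hN0, hNle, hbound⟩ := exists_weights hJ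
  set H := Real.pi ^ 2 * Real.log J / (2 * J * (4 - Real.pi ^ 2 / J)) + 1 / J with hH
  have hJ4 : (4 : ℝ) ≤ J := by exact_mod_cast hJ
  have hm1 : (1 : ℝ) ≤ m := by exact_mod_cast hm
  have hpi : Real.pi ^ 2 < 10 := by nlinarith [Real.pi_lt_d2, Real.pi_gt_three]
  have hpiJ : Real.pi ^ 2 / J < 3 := by rw [div_lt_iff₀ (by linarith)]; linarith
  have hH0 : 0 ≤ H := by
    have h1 : 0 ≤ 4 - Real.pi ^ 2 / J := by linarith
    have h2 : 0 ≤ Real.log J := Real.log_nonneg (by linarith)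
    positivity
  have hσn : ‖(σ : ℂ)‖ = 1 := by rcases hσ with rfl | rfl <;> simp
  have hσ2 : (σ : ℂ) ^ 2 = 1 := by rcases hσ with rfl | rfl <;> simp
  have hne : ∀ α ∈ complexRoots P, ∀ k, 0 < k → ((σ : ℂ) * α ^ m) ^ k ≠ 1 := by
    intro α hα k hk h
    have h2 := congrArg (fun z => z ^ 2) h
    simp only [one_pow] at h2
    rw [← pow_mul, mul_comm k 2, pow_mul, mul_pow, hσ2, one_mul, ← pow_mul, ← pow_mul] at h2
    exact pow_ne_one_of_root hP hirr hM (by positivity) hα h2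
  have hres : ∀ k, 0 < k → 0 ≤ ∑ α ∈ complexRoots P, Real.log ‖1 - ((σ : ℂ) * α ^ m) ^ k‖ := by
    intro k hk
    have e : ∀ α : ℂ, aeval α (1 - (Polynomial.C σ * X ^ m) ^ k : ℤ[X]) = 1 - ((σ : ℂ) * α ^ m) ^ k := by
      intro α; simp
    have := sum_log_norm_aeval_nonneg hP hirr (1 - (Polynomial.C σ * X ^ m) ^ k) (fun α hα => by
      rw [e]; exact sub_ne_zero.2 (hne α hα k hk).symm)
    simpa only [e] using this
  have h0 : 0 ≤ ∑ α ∈ complexRoots P, ∑ x ∈ I,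
      w x * Real.log ‖1 - ((σ : ℂ) * α ^ m) ^ n x‖ := by
    rw [Finset.sum_comm]
    refine Finset.sum_nonneg fun x hx => ?_
    rw [← Finset.mul_sum]
    exact mul_nonneg (hI x hx).1 (hres _ (hI x hx).2.1)
  have hfar : ∀ α ∈ complexRoots P, ∑ x ∈ I, w x * Real.log ‖1 - ((σ : ℂ) * α ^ m) ^ n x‖
      ≤ H + N * m * Real.posLog ‖α‖ := by
    intro α hα
    have := hbound _ (hne α hα)
    rwa [norm_mul, hσn, one_mul, posLog_norm_pow, ← mul_assoc] at this
  have hnear : ∀ α ∈ C, ∑ x ∈ I, w x * Real.log ‖1 - ((σ : ℂ) * α ^ m) ^ n x‖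
      ≤ Real.log δ + Real.log (m * J) + N * m * Real.posLog ‖α‖ := by
    intro α hα
    have hterm : ∀ x ∈ I, w x * Real.log ‖1 - ((σ : ℂ) * α ^ m) ^ n x‖
        ≤ w x * (Real.log δ + Real.log (m * J)) + w x * n x * (m * Real.posLog ‖α‖) := by
      intro x hx
      obtain ⟨hx0, hxn, hxJ⟩ := hI x hx
      have h1 := hclose α hα (n x)
      have hpos : 0 < ‖1 - ((σ : ℂ) * α ^ m) ^ n x‖ :=
        norm_pos_iff.2 (sub_ne_zero.2 (hne α (hC hα) _ hxn).symm)
      have hn0 : (0 : ℝ) < n x := by exact_mod_cast hxn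
      have hnJ : (n x : ℝ) ≤ J := by exact_mod_cast hxJ.le
      have h2 : ‖1 - ((σ : ℂ) * α ^ m) ^ n x‖ ≤ m * J * δ * max 1 ‖α‖ ^ (m * n x) := by
        refine h1.trans ?_
        push_cast
        gcongr
      have h3 := Real.log_le_log hpos h2
      rw [Real.log_mul (by positivity) (by positivity), Real.log_mul (by positivity) hδ.ne',
        Real.log_pow, ← Real.posLog_eq_log_max_one (norm_nonneg _)] at h3
      push_cast at h3
      have := mul_le_mul_of_nonneg_left h3 hx0
      linarith
    refine (Finset.sum_le_sum hterm).trans (le_of_eq ?_)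
    rw [Finset.sum_add_distrib, ← Finset.sum_mul, ← Finset.sum_mul, hw1, hwN]
    ring
  have hall : ∀ α ∈ complexRoots P, ∑ x ∈ I, w x * Real.log ‖1 - ((σ : ℂ) * α ^ m) ^ n x‖
      ≤ H + N * m * Real.posLog ‖α‖ + if α ∈ C then Real.log δ + Real.log (m * J) else 0 := by
    intro α hα
    split_ifs with h
    · linarith [hnear α h]
    · linarith [hfar α hα]
  have hsum := h0.trans (Finset.sum_le_sum hall)
  rw [Finset.sum_add_distrib, Finset.sum_add_distrib, Finset.sum_const, ← Finset.mul_sum,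
    ← log_mahlerMeasure_eq hP hirr, card_complexRoots hP hirr, ← Finset.sum_filter,
    Finset.sum_const, Finset.filter_mem_eq_inter, Finset.inter_eq_right.2 hC, nsmul_eq_mul,
    nsmul_eq_mul] at hsum
  have hℓ := (Real.log_pos hM).le
  have hNm : N * m * Real.log (P.map (Int.castRingHom ℂ)).mahlerMeasure
      ≤ m * J * Real.log (P.map (Int.castRingHom ℂ)).mahlerMeasure / (4 - Real.pi ^ 2 / J) := by
    calc _ ≤ J / (4 - Real.pi ^ 2 / J) * m *
          Real.log (P.map (Int.castRingHom ℂ)).mahlerMeasure := by gcongr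
      _ = _ := by ring
  linarith

theorem inv_mem_complexRoots {P : ℤ[X]} (hP : P.Monic) (hrev : P.reverse = P) {α : ℂ}
    (hα : α ∈ complexRoots P) : α⁻¹ ∈ complexRoots P ∧ α ≠ 0 := by
  rw [mem_complexRoots hP] at hα ⊢
  have hα0 : α ≠ 0 := by
    rintro rfl
    have h1 : P.coeff 0 = 1 := by rw [← hrev, coeff_zero_reverse]; exact hP
    rw [← coeff_zero_eq_aeval_zero', h1] at hα
    simp at hα
  refine ⟨?_, hα0⟩
  let := invertibleOfNonzero hα0
  have h := (eval₂_reverse_eq_zero_iff (algebraMap ℤ ℂ) α P).2 (by rwa [aeval_def] at hα)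
  rwa [hrev, invOf_eq_inv, ← aeval_def] at h

theorem conj_mem_complexRoots {P : ℤ[X]} (hP : P.Monic) {α : ℂ} (hα : α ∈ complexRoots P) :
    (starRingEnd ℂ) α ∈ complexRoots P := by
  rw [mem_complexRoots hP] at hα ⊢
  have h := congrArg (starRingEnd ℂ) hα
  rw [map_zero, aeval_def, hom_eval₂,
    RingHom.ext_int ((starRingEnd ℂ).comp (algebraMap ℤ ℂ)) (algebraMap ℤ ℂ)] at h
  exact h

end

set_option maxHeartbeats 1000000 in
/-- Optimisation of the number of exponents `J`. -/
theorem exists_J_le {m d ℓ η : ℝ} (hm : 1 ≤ m) (hη : 0 < η) (hη4 : η ≤ 1 / 4) (hd : 1 ≤ d)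
    (hℓ0 : 0 < ℓ) (hδ : ℓ ≤ 4 * η ^ 2 / (Real.pi ^ 2 * m) * (d * Real.log d))
    (hℓ : d ^ (-η) ≤ ℓ)
    (h1 : Real.log 4 + 1 / 2 * Real.log (Real.log d) ≤ η / 2 * Real.log d)
    (h2 : m / η ≤ Real.log d) (h3 : 8 * Real.log d ≤ η * d ^ (1 / 4 : ℝ))
    (h4 : Real.log m ≤ Real.log d) :
    ∃ J : ℕ, 4 ≤ J ∧
      d * (Real.pi ^ 2 * Real.log J / (2 * J * (4 - Real.pi ^ 2 / J)) + 1 / J) +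
      m * J * ℓ / (4 - Real.pi ^ 2 / J) + 4 * Real.log (m * J)
      ≤ (Real.pi * √m / 4 + 6 * m * η) * √(d * Real.log d * ℓ) := by
  set D := Real.log d with hD
  have hπ3 := Real.pi_gt_three
  have hπ4 := Real.pi_lt_d2
  have hD1 : 1 ≤ D := by
    refine le_trans ?_ h2
    rw [le_div_iff₀ hη]; linarith
  have hdD : 0 < d * D := by positivity
  rw [Real.sqrt_mul hdD.le]
  set a := √(d * D) with ha
  set b := √ℓ with hb
  set s := √m with hs
  have ha0 : 0 < a := Real.sqrt_pos.2 hdD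
  have hb0 : 0 < b := Real.sqrt_pos.2 hℓ0
  have hs1 : 1 ≤ s := Real.one_le_sqrt.2 hm
  have ha2 : a ^ 2 = d * D := Real.sq_sqrt hdD.le
  have hb2 : b ^ 2 = ℓ := Real.sq_sqrt hℓ0.le
  have hs2 : s ^ 2 = m := Real.sq_sqrt (by linarith)
  have hsm : s ≤ m := by rw [← hs2, sq]; exact le_mul_of_one_le_left (by linarith) hs1
  set v := a * b with hv
  have hv0 : 0 < v := by positivity
  -- The minimiser of π²dD/(16u) + mℓu/4, where both terms equal (π/8)·s·v. The actual J is ⌊u⌋ + 1.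
  set u := Real.pi / 2 * (a / (s * b)) with hu
  have hu0 : 0 < u := by positivity
  have hdu : d * D = 2 / Real.pi * s * v * u := by
    rw [← ha2, hu, hv]; field_simp
  have hmu : m * ℓ * u = Real.pi / 2 * s * v := by
    rw [← hs2, ← hb2, hu, hv]; field_simp
  have hab : Real.pi * s * b ≤ 2 * η * a := by
    refine (sq_le_sq₀ (by positivity) (by positivity)).1 ?_
    rw [div_mul_eq_mul_div, le_div_iff₀ (by positivity), ← ha2, ← hb2, ← hs2] at hδ
    linarith
  -- The smallness assumption `hδ` is exactly this: it makes π²/J ≤ 4η, so the denominators 4 - π²/J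
  -- are nearly 4.
  have huη : Real.pi ^ 2 ≤ 4 * η * u := by
    have : Real.pi ≤ 2 * η * (a / (s * b)) := by
      rw [mul_div_assoc', le_div_iff₀ (by positivity)]; linarith
    have := mul_le_mul_of_nonneg_left this Real.pi_pos.le
    rw [hu]; linarith
  have hπ9 : 9 ≤ Real.pi ^ 2 := by nlinarith only [hπ3]
  have hu1 : 1 ≤ η * u := by linarith
  have hu4 : 4 ≤ u := by
    have := mul_le_mul_of_nonneg_right hη4 hu0.le
    linarith
  have hJu : u < (⌊u⌋₊ + 1 : ℕ) := by push_cast; exact Nat.lt_floor_add_one u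
  have hJu1 : ((⌊u⌋₊ + 1 : ℕ) : ℝ) ≤ u + 1 := by
    push_cast; linarith [Nat.floor_le hu0.le]
  set J := ⌊u⌋₊ + 1 with hJ
  clear_value J
  refine ⟨J, by have : (4 : ℝ) < J := by linarith
                exact_mod_cast this.le, ?_⟩
  have hJ0 : (0 : ℝ) < J := by linarith
  have hq : 4 * (1 - η) ≤ 4 - Real.pi ^ 2 / J := by
    have : Real.pi ^ 2 / J ≤ 4 * η := by
      rw [div_le_iff₀ hJ0]
      exact huη.trans (mul_le_mul_of_nonneg_left hJu.le (by linarith))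
    linarith
  set q := 4 - Real.pi ^ 2 / J with hqdef
  clear_value q
  have hη1 : 0 < 1 - η := by linarith
  have hq0 : 0 < q := by linarith
  -- The lower bound on ℓ enters here. Without it log J could be larger than about half of log d,
  -- and the leading constant would grow.
  have hlogJ : Real.log J ≤ (1 / 2 + η) * D := by
    have e1 : (J : ℝ) ≤ 4 * (a / b) := by
      have : u ≤ 2 * (a / b) := by
        have h5 : a / (s * b) ≤ a / b :=
          div_le_div_of_nonneg_left ha0.le hb0 (le_mul_of_one_le_left hb0.le hs1)
        have h6 : 0 < a / b := by positivity
        rw [hu]; nlinarith only [h5, h6, hπ3, hπ4]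
      linarith
    have e2 := Real.log_le_log hJ0 e1
    rw [Real.log_mul (by norm_num) (by positivity), Real.log_div ha0.ne' hb0.ne', ha, hb,
      Real.log_sqrt hdD.le, Real.log_sqrt hℓ0.le, Real.log_mul (by positivity) (by positivity),
      ← hD] at e2
    have e3 := Real.log_le_log (by positivity) hℓ
    rw [Real.log_rpow (by positivity), ← hD] at e3
    linarith
  have hlogJ0 : 0 ≤ Real.log J := Real.log_nonneg (by linarith)
  have hvsqrt : v = √(d * D * ℓ) := by rw [Real.sqrt_mul hdD.le]
  clear_value v u a b s D
  have tA : d * (Real.pi ^ 2 * Real.log J / (2 * J * q))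
      ≤ Real.pi / 8 * s * v * ((1 + 2 * η) / (1 - η)) := by
    calc d * (Real.pi ^ 2 * Real.log J / (2 * J * q))
        ≤ d * (Real.pi ^ 2 * ((1 / 2 + η) * D) / (2 * u * (4 * (1 - η)))) := by gcongr
      _ = Real.pi ^ 2 * (1 / 2 + η) * (d * D) / (2 * u * (4 * (1 - η))) := by ring
      _ = _ := by rw [hdu]; field_simp; ring
  have tB : d * (1 / J) ≤ η * v := by
    have hDη : m ≤ D * η := by rwa [div_le_iff₀ hη] at h2
    have e1 : d * (1 / J) ≤ d / u := by
      rw [mul_one_div]; gcongr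
    refine e1.trans ?_
    rw [div_le_iff₀ hu0]
    have e2 : d * D ≤ D * (η * v * u) := by
      rw [hdu]
      have h5 : 2 / Real.pi ≤ 1 := by rw [div_le_one (by linarith)]; linarith
      have h6 : 2 / Real.pi * s ≤ D * η := by
        calc 2 / Real.pi * s ≤ 1 * s := by gcongr
          _ ≤ D * η := by linarith
      calc 2 / Real.pi * s * v * u ≤ D * η * v * u := by gcongr
        _ = _ := by ring
    rw [mul_comm] at e2
    exact le_of_mul_le_mul_left e2 (by linarith)
  have tC : m * J * ℓ / q ≤ Real.pi / 8 * s * v * ((1 + η) / (1 - η)) := by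
    have e1 : (J : ℝ) ≤ u * (1 + η) := by linarith
    calc m * J * ℓ / q ≤ m * (u * (1 + η)) * ℓ / (4 * (1 - η)) := by gcongr
      _ = (m * ℓ * u) * (1 + η) / (4 * (1 - η)) := by ring
      _ = _ := by rw [hmu]; field_simp; ring
  have tD : 4 * Real.log (m * J) ≤ η * v := by
    rw [Real.log_mul (by positivity) hJ0.ne']
    have e1 : d ^ (1 / 4 : ℝ) ≤ v := by
      rw [hvsqrt]
      refine Real.le_sqrt_of_sq_le ?_
      rw [← Real.rpow_natCast, ← Real.rpow_mul (by linarith)]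
      calc d ^ (1 / 4 * ((2 : ℕ) : ℝ)) ≤ d ^ (1 + -η) :=
            Real.rpow_le_rpow_of_exponent_le hd (by push_cast; linarith)
        _ = d * d ^ (-η) := by rw [Real.rpow_add (by linarith), Real.rpow_one]
        _ ≤ d * D * ℓ := by
            have : d ≤ d * D := le_mul_of_one_le_right (by linarith) hD1
            gcongr
    have e3 : η * d ^ (1 / 4 : ℝ) ≤ η * v := by gcongr
    have e4 : (1 / 2 + η) * D ≤ 1 * D := mul_le_mul_of_nonneg_right (by linarith) (by linarith)
    linarith
  have hfrac : (1 + 2 * η) / (1 - η) + (1 + η) / (1 - η) ≤ 2 + 10 * η := by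
    rw [← add_div, div_le_iff₀ hη1]; nlinarith only [hη, hη4]
  have t1 : Real.pi / 8 * s * v * ((1 + 2 * η) / (1 - η)) +
      Real.pi / 8 * s * v * ((1 + η) / (1 - η)) ≤ Real.pi / 8 * s * v * (2 + 10 * η) := by
    rw [← mul_add]; gcongr
  have t2 : Real.pi / 8 * s * v * (10 * η) ≤ 4 * m * η * v := by
    have : Real.pi / 8 * 10 ≤ 4 := by linarith
    calc Real.pi / 8 * s * v * (10 * η) = Real.pi / 8 * 10 * s * (η * v) := by ring
      _ ≤ 4 * m * (η * v) := by gcongr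
      _ = _ := by ring
  have t3 : 2 * (η * v) ≤ 2 * m * (η * v) :=
    mul_le_mul_of_nonneg_right (by linarith) (mul_pos hη hv0).le
  rw [mul_add]
  linarith

/-! ### Large degrees and the final count of close roots -/

section

open Polynomial

/-- The total loss in the optimisation is 6mη, which fixes η in terms of ε. At most four close roots
are allowed, so their log(mJ) terms stay of lower order. -/
theorem eventually_close_roots_bound (m : ℕ) (hm : 1 ≤ m) (ε : ℝ) (hε : 0 < ε) :
    ∃ D₀ : ℕ, ∃ δ₀ : ℝ, 0 < δ₀ ∧
      ∀ P : ℤ[X], P.Monic → Irreducible P →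
        1 < (P.map (Int.castRingHom ℂ)).mahlerMeasure →
        D₀ ≤ P.natDegree →
        Real.log (P.map (Int.castRingHom ℂ)).mahlerMeasure ≤
          δ₀ * ((P.natDegree : ℝ) * Real.log (P.natDegree : ℝ)) →
        ∀ (σ : ℤ) (δ : ℝ) (C : Finset ℂ), (σ = 1 ∨ σ = -1) → 0 < δ → C ⊆ complexRoots P →
          C.card ≤ 4 → (∀ β ∈ C, CloseToSign m σ δ β) →
          C.card * -Real.log δ ≤ (Real.pi * √(m : ℝ) / 4 + ε) *
              √((P.natDegree : ℝ) * Real.log (P.natDegree : ℝ) *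
                Real.log (P.map (Int.castRingHom ℂ)).mahlerMeasure) := by
  have hm1 : (1 : ℝ) ≤ m := by exact_mod_cast hm
  set η : ℝ := min (1 / 4) (ε / (6 * m)) with hη
  have hη0 : 0 < η := lt_min (by norm_num) (by positivity)
  have hη4 : η ≤ 1 / 4 := min_le_left _ _
  have hηε : 6 * m * η ≤ ε := by
    have : η ≤ ε / (6 * m) := min_le_right _ _
    rwa [le_div_iff₀ (by positivity), mul_comm] at this
  have hlog := Real.tendsto_log_atTop
  have a1 : ∀ᶠ x : ℝ in Filter.atTop, ‖Real.log x‖ ≤ (η / 4) * ‖x‖ :=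
    Real.isLittleO_log_id_atTop.bound (by positivity)
  have a3 : ∀ᶠ x : ℝ in Filter.atTop, ‖Real.log x‖ ≤ (η / 8) * ‖x ^ (1 / 4 : ℝ)‖ :=
    (isLittleO_log_rpow_atTop (by norm_num : (0 : ℝ) < 1 / 4)).bound (by positivity)
  have hcast := tendsto_natCast_atTop_atTop (R := ℝ)
  have hev := (rpow_neg_le_log_mahlerMeasure hη0 (by linarith)).and
    ((hcast.eventually (hlog.eventually a1)).and ((hcast.eventually a3).and
    ((hcast.eventually (hlog.eventually_ge_atTop (4 * Real.log 4 / η))).and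
    ((hcast.eventually (hlog.eventually_ge_atTop (m / η))).and
    ((hcast.eventually (hlog.eventually_ge_atTop (Real.log m))).and
    (Filter.eventually_ge_atTop 1))))))
  obtain ⟨D₀, hD₀⟩ := Filter.eventually_atTop.1 hev
  refine ⟨D₀, 4 * η ^ 2 / (Real.pi ^ 2 * m), by positivity, ?_⟩
  intro P hP hirr hM hdeg hsmall σ δ C hσ hδ hC hcard hclose
  obtain ⟨b1, b2, b3, b4, b5, b6, b7⟩ := hD₀ _ hdeg
  have hd1 : (1 : ℝ) ≤ P.natDegree := by exact_mod_cast b7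
  have hL0 : 0 ≤ Real.log (P.natDegree : ℝ) := Real.log_nonneg hd1
  rw [Real.norm_of_nonneg hL0, Real.norm_of_nonneg (by positivity)] at b3
  rw [Real.norm_of_nonneg hL0] at b2
  rw [div_le_iff₀ hη0] at b4
  have hηL := mul_nonneg hη0.le hL0
  have b2' := (Real.le_norm_self _).trans b2
  obtain ⟨J, hJ, hJle⟩ := exists_J_le (m := m) hm1 hη0 hη4 hd1 (Real.log_pos hM) hsmall
    (b1 P hP hirr hM rfl) (by linarith) b5 (by linarith) b6
  have hmain := card_mul_neg_log_le hP hirr hM hm hσ hδ hC hclose hJ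
  have hlogmJ : 0 ≤ Real.log (m * J) := by
    have hJ1 : (1 : ℝ) ≤ J := by exact_mod_cast (by omega : 1 ≤ J)
    exact Real.log_nonneg (one_le_mul_of_one_le_of_one_le hm1 hJ1)
  have hc4 : (C.card : ℝ) ≤ 4 := by exact_mod_cast hcard
  have h5 := mul_le_mul_of_nonneg_right hc4 hlogmJ
  have h6 : (Real.pi * √(m : ℝ) / 4 + 6 * m * η) * √((P.natDegree : ℝ) *
      Real.log (P.natDegree : ℝ) * Real.log (P.map (Int.castRingHom ℂ)).mahlerMeasure)
      ≤ (Real.pi * √(m : ℝ) / 4 + ε) * √((P.natDegree : ℝ) *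
      Real.log (P.natDegree : ℝ) * Real.log (P.map (Int.castRingHom ℂ)).mahlerMeasure) := by
    gcongr
  linarith

end

theorem mainTheorem7 (m : ℕ) (hm : 1 ≤ m) (ε : ℝ) (hε : 0 < ε) :
    ∃ D₀ : ℕ, ∃ δ : ℝ, 0 < δ ∧
      ∀ P : Polynomial ℤ, P.Monic → Irreducible P → P.reverse = P →
        1 < (P.map (Int.castRingHom ℂ)).mahlerMeasure →
        D₀ ≤ P.natDegree →
        Real.log (P.map (Int.castRingHom ℂ)).mahlerMeasure ≤
          δ * ((P.natDegree : ℝ) * Real.log (P.natDegree : ℝ)) →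
        ∀ μ ω : ℂ, Polynomial.aeval μ P = 0 → (ω ^ m = 1 ∨ ω ^ m = -1) →
          Real.exp (-((Real.pi * Real.sqrt (m : ℝ) / 8 + ε) *
              Real.sqrt ((P.natDegree : ℝ) * Real.log (P.natDegree : ℝ) *
                Real.log (P.map (Int.castRingHom ℂ)).mahlerMeasure))) ≤ ‖ω - μ‖ ∧
          (μ.im ≠ 0 → ‖μ‖ ≠ 1 →
            Real.exp (-((Real.pi * Real.sqrt (m : ℝ) / 16 + ε) *
              Real.sqrt ((P.natDegree : ℝ) * Real.log (P.natDegree : ℝ) *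
                Real.log (P.map (Int.castRingHom ℂ)).mahlerMeasure))) ≤ ‖ω - μ‖) := by
  obtain ⟨D₀, δ, hδ, h⟩ := eventually_close_roots_bound m hm ε hε
  refine ⟨D₀, δ, hδ, fun P hP hirr hrev hM hdeg hsmall μ ω hμ hω => ?_⟩
  have hmem := (mem_complexRoots hP).2 hμ
  obtain ⟨σ, hσ, hωσ⟩ : ∃ σ : ℤ, (σ = 1 ∨ σ = -1) ∧ ω ^ m = σ := by
    rcases hω with h | h
    · exact ⟨1, Or.inl rfl, by simpa using h⟩
    · exact ⟨-1, Or.inr rfl, by simpa using h⟩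
  obtain ⟨hinv, hμ0⟩ := inv_mem_complexRoots hP hrev hmem
  have hpos : 0 < ‖ω - μ‖ := by
    refine norm_pos_iff.2 (sub_ne_zero.2 ?_)
    rintro rfl
    refine pow_ne_one_of_root hP hirr hM (n := m * 2) (by omega) hmem ?_
    rw [pow_mul, hωσ]
    rcases hσ with rfl | rfl <;> simp
  have hμinv : μ ≠ μ⁻¹ := by
    intro e
    refine pow_ne_one_of_root hP hirr hM two_ne_zero hmem ?_
    rw [sq]
    nth_rewrite 2 [e]
    exact mul_inv_cancel₀ hμ0
  have hself := closeToSign_self (by omega : m ≠ 0) hσ hωσ μ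
  have hcinv := hself.inv hσ hμ0
  have hbound := h P hP hirr hM hdeg hsmall σ ‖ω - μ‖
  set v := √((P.natDegree : ℝ) * Real.log (P.natDegree : ℝ) *
    Real.log (P.map (Int.castRingHom ℂ)).mahlerMeasure)
  -- Dividing by the number of close roots leaves ε/2 or ε/4; this inequality restores the full ε.
  have hv : 0 ≤ ε * v := mul_nonneg hε.le (Real.sqrt_nonneg _)
  constructor
  · rw [← Real.le_log_iff_exp_le hpos]
    have hb := hbound {μ, μ⁻¹} hσ hpos
      (by
        intro z hz
        simp only [Finset.mem_insert, Finset.mem_singleton] at hz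
        rcases hz with rfl | rfl <;> assumption)
      (Finset.card_le_two.trans (by norm_num))
      (by
        intro z hz
        simp only [Finset.mem_insert, Finset.mem_singleton] at hz
        rcases hz with rfl | rfl <;> assumption)
    rw [Finset.card_pair hμinv] at hb
    push_cast at hb
    linarith
  · intro him hnorm
    rw [← Real.le_log_iff_exp_le hpos]
    have hconj := conj_mem_complexRoots hP hmem
    have hconjinv := conj_mem_complexRoots hP hinv
    have hcc := hself.conj
    have hcci := hcinv.conj
    -- The four roots μ, 1/μ and their conjugates are distinct: μ is not real, and |μ| ≠ 1 separates
    -- μ from the inverse of its conjugate.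
    have n1 : μ ≠ (starRingEnd ℂ) μ := fun e => him (Complex.conj_eq_iff_im.1 e.symm)
    have n2 : μ⁻¹ ≠ (starRingEnd ℂ) μ⁻¹ := fun e => by
      rw [map_inv₀] at e
      exact n1 (inv_injective e)
    have hnn : ‖μ‖ ≠ ‖μ⁻¹‖ := fun e => by
      rw [norm_inv] at e
      have h0 : 0 < ‖μ‖ := norm_pos_iff.2 hμ0
      have : ‖μ‖ * ‖μ‖ = 1 := by
        nth_rewrite 2 [e]
        exact mul_inv_cancel₀ h0.ne'
      exact hnorm (by nlinarith)
    have n3 : μ ≠ (starRingEnd ℂ) μ⁻¹ := fun e => hnn (by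
      rw [← RCLike.norm_conj μ⁻¹, ← e])
    have n4 : μ⁻¹ ≠ (starRingEnd ℂ) μ := fun e => hnn (by
      rw [e, RCLike.norm_conj])
    have n5 : (starRingEnd ℂ) μ ≠ (starRingEnd ℂ) μ⁻¹ := fun e =>
      hμinv ((starRingEnd ℂ).injective e)
    have hcard : ({μ, μ⁻¹, (starRingEnd ℂ) μ, (starRingEnd ℂ) μ⁻¹} : Finset ℂ).card = 4 := by
      rw [Finset.card_insert_of_notMem (by simp [hμinv, n1, n3, -map_inv₀]),
        Finset.card_insert_of_notMem (by simp [n4, n2, -map_inv₀]), Finset.card_pair n5]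
    have hb := hbound {μ, μ⁻¹, (starRingEnd ℂ) μ, (starRingEnd ℂ) μ⁻¹} hσ hpos
      (by
        intro z hz
        simp only [Finset.mem_insert, Finset.mem_singleton] at hz
        rcases hz with rfl | rfl | rfl | rfl <;> assumption)
      hcard.le
      (by
        intro z hz
        simp only [Finset.mem_insert, Finset.mem_singleton] at hz
        rcases hz with rfl | rfl | rfl | rfl <;> assumption)
    rw [hcard] at hb
    push_cast at hb
    linarith
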